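/- Let $X_1(15)$ be the compactification over $\mathbb{Q}$ of the modular curve $Y_1(15)$ whose $K$-rational points, for every field $K\supseteq\mathbb{Q}$, classify the $K$-isomorphism classes of pairs $(E,P)$, where $E$ is an elliptic curve over $K$ and $P\in E(K)$ has exact order $15$. This modular curve is an elliptic curve over $\mathbb{Q}$. For nonzero $d\in\mathbb{Q}$ let $X_1^{(d)}(15)$ denote its quadratic twist by $d$: if $X_1(15)$ is given by $y^2=x^3+a_2x^2+a_4x+a_6$, then $X_1^{(d)}(15)$ is $y^2=x^3+da_2x^2+d^2a_4x+d^3a_6$. Let $p$ be a prime with $p\equiv 7 \pmod 8$, $p\equiv 2\pmod 3$ and $\left(\frac{p}{5}\right)=-1$. Then $$\operatorname{rank} X_1^{(p)}(15)(\mathbb{Q})=\operatorname{rank} X_1^{(-15p)}(15)(\mathbb{Q})=0.$$ -/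

import Mathlib

/-- An elliptic curve over a field `K`, given by a Weierstrass equation, together with a
`K`-rational affine point `(x, y)` of exact order `N` (for `N ≥ 2` every point of order `N` is
affine). -/
structure EllipticCurveWithPoint (N : ℕ) (K : Type) [Field K] where
  /-- the Weierstrass equation -/
  curve : WeierstrassCurve K
  /-- the equation defines an elliptic curve -/
  isElliptic : curve.IsElliptic
  /-- first coordinate of the point -/
  x : K
  /-- second coordinate of the point -/
  y : K
  /-- the point lies on the curve -/
  nonsingular : curve.toAffine.Nonsingular x y
  /-- the point has exact order `N` in the Mordell-Weil group -/
  order_eq : letI := Classical.decEq K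
    addOrderOf (WeierstrassCurve.Affine.Point.some x y nonsingular) = N

namespace EllipticCurveWithPoint

variable {N : ℕ} {K L : Type} [Field K] [Field L]

/-- Two pairs are isomorphic over `K` if an admissible change of Weierstrass coordinates
`(X, Y) = (u² X' + r, u³ Y' + u² s X' + t)` over `K` carries one curve to the other and
identifies the marked points. -/
def Isomorphic (A B : EllipticCurveWithPoint N K) : Prop :=
  ∃ C : WeierstrassCurve.VariableChange K, C • A.curve = B.curve ∧
    A.x = (C.u : K) ^ 2 * B.x + C.r ∧
    A.y = (C.u : K) ^ 3 * B.y + (C.u : K) ^ 2 * C.s * B.x + C.t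

/-- `B` is the pair over `L` obtained from the pair `A` over `K` by extending scalars along `φ`. -/
def IsBaseChange (φ : K →+* L) (A : EllipticCurveWithPoint N K)
    (B : EllipticCurveWithPoint N L) : Prop :=
  B.curve = A.curve.map φ ∧ B.x = φ A.x ∧ B.y = φ A.y

end EllipticCurveWithPoint

open Classical in
/-- The elliptic curve `X` over `ℚ` is (a Weierstrass model of) the modular curve `X₁(N)`, `N ≥ 4`:
functorially in the extension field `K` of `ℚ`, the isomorphism classes over `K` of elliptic curves
with a `K`-point of exact order `N` are in bijection with the `K`-points of `X` outside a finite set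
(the cusps). As `X` is a smooth projective curve, this determines it up to isomorphism over `ℚ`. -/
def IsModularCurveX₁ (N : ℕ) (X : WeierstrassCurve ℚ) : Prop :=
  X.IsElliptic ∧
  ∃ f : ∀ (K : Type) [Field K] [Algebra ℚ K],
      EllipticCurveWithPoint N K → (X.baseChange K).toAffine.Point,
    (∀ (K : Type) [Field K] [Algebra ℚ K] (A B : EllipticCurveWithPoint N K),
      f K A = f K B ↔ A.Isomorphic B) ∧
    (∀ (K : Type) [Field K] [Algebra ℚ K], (Set.range (f K))ᶜ.Finite) ∧
    (∀ (K L : Type) [Field K] [Algebra ℚ K] [Field L] [Algebra ℚ L] (φ : K →ₐ[ℚ] L)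
      (A : EllipticCurveWithPoint N K) (B : EllipticCurveWithPoint N L),
      EllipticCurveWithPoint.IsBaseChange φ.toRingHom A B →
        WeierstrassCurve.Affine.Point.map (W' := X) φ (f K A) = f L B)

/-- The quadratic twist `W^(d)` of a Weierstrass curve over `ℚ`. Completing the square brings `W`
to the form `y² = x³ + (b₂/4) x² + (b₄/2) x + b₆/4`, and the twist by `d` is
`y² = x³ + d (b₂/4) x² + d² (b₄/2) x + d³ (b₆/4)`. -/
def quadraticTwist (W : WeierstrassCurve ℚ) (d : ℚ) : WeierstrassCurve ℚ where
  a₁ := 0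
  a₂ := d * (W.b₂ / 4)
  a₃ := 0
  a₄ := d ^ 2 * (W.b₄ / 2)
  a₆ := d ^ 3 * (W.b₆ / 4)

/-- The rank of the Mordell-Weil group `W(ℚ)`, as a cardinal: the supremum of the cardinalities of
`ℤ`-linearly independent sets of rational points. -/
noncomputable def mordellWeilRank (W : WeierstrassCurve ℚ) : Cardinal :=
  Module.rank ℤ W.toAffine.Point

/-!
The curve `E : y² + xy + y = x³ + x²` is a model of `X₁(15)`, and the ranks of its twists are
bounded by descent through `2`-isogenies.

*The modular curve.* A pair `(W, P)` with `P` of order `15` has a unique Tate normal form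
`y² + (1 - c)xy - by = x³ - bx²` with `P = (0, 0)`, so isomorphism classes of pairs correspond to
the parameters `(b, c)`. In the coordinates `r = b / c` and `s = c / (r - 1)` one computes
`5P = (rs(s - 1), rs²(r - s))`, and the condition that `5P` is an inflection point becomes one plane
equation, which is birational to `y² + xy + y = x³ + x²`. The birational map is a bijection outside
the zeros of an explicit polynomial in `x` (the cusps), over every field of characteristic zero:
`isModularCurveX₁_modelX₁Fifteen`.

*Independence of the model.* The definition of a model only controls points up to a finite set, so
the rank of a twist is read off from finiteness of point sets. If `δ² = d`, the twist by `d` of any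
model `X` embeds into `X(ℚ(δ))`; this set is finite as soon as `E(ℚ(δ))` is, since both contain the
isomorphism classes of pairs over `ℚ(δ)` up to finitely many points. Finally `E(ℚ(δ))` is finite if
the rational points of `E` and of its twist by `d` are finite in number:
`IsModularCurveX₁.mordellWeilRank_quadraticTwist`.

*Descent.* The twist of `E` by `d` is `y² = x(x² - 7dx + 16d²)`, with the `2`-isogenous curve
`Y² = X(X + 15d)(X - d)`. For `d = 1`, `p` and `-15p` local arguments at `2`, `3`, `5` and `p` show
that `x` is always a square, and that the class of `X` modulo squares is one of the classes of the
rational torsion points. Every rational point is therefore twice a point up to torsion. The group is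
finitely generated, by the approximate parallelogram law for the naive height
(`WeierstrassCurve.Affine.Point.exists_abs_logHeight_xRep_le`) and the Northcott property, so it is
finite: `twistModel.finite_one`, `twistModel.finite_prime`,
`twistModel.finite_neg_fifteen_mul_prime`.
-/

/-! ### Chords, tangents and changes of coordinates -/

namespace WeierstrassCurve.Affine.Point

variable {K : Type*} [Field K] [DecidableEq K] {W : WeierstrassCurve.Affine K}

/-- Addition of two points with distinct `x`-coordinates, with the slope `ℓ` of the chord given
by its defining property instead of a quotient. -/
lemma exists_add_eq_some_of_chord {x₁ y₁ x₂ y₂ ℓ x₃ y₃ : K} (h₁ : W.Nonsingular x₁ y₁)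
    (h₂ : W.Nonsingular x₂ y₂) (hx : x₁ ≠ x₂) (hℓ : ℓ * (x₁ - x₂) = y₁ - y₂)
    (hx₃ : x₃ = ℓ ^ 2 + W.a₁ * ℓ - W.a₂ - x₁ - x₂)
    (hy₃ : y₃ = -(ℓ * (x₃ - x₁) + y₁) - W.a₁ * x₃ - W.a₃) :
    ∃ h₃ : W.Nonsingular x₃ y₃, some x₁ y₁ h₁ + some x₂ y₂ h₂ = some x₃ y₃ h₃ := by
  have hs : W.slope x₁ x₂ y₁ y₂ = ℓ := by
    rw [slope_of_X_ne hx, div_eq_iff (sub_ne_zero.mpr hx), hℓ]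
  have hX : W.addX x₁ x₂ (W.slope x₁ x₂ y₁ y₂) = x₃ := by rw [hs, addX, hx₃]
  have hY : W.addY x₁ x₂ y₁ (W.slope x₁ x₂ y₁ y₂) = y₃ := by
    rw [addY, negAddY, hX, hs, negY, hy₃]
  have := nonsingular_add h₁ h₂ fun hxy => hx hxy.left
  rw [add_of_X_ne hx]
  simp only [hX, hY] at this ⊢
  exact ⟨this, trivial⟩

/-- Doubling of a point, with the slope `ℓ` of the tangent given by its defining property. -/
lemma exists_add_self_eq_some_of_tangent {x₁ y₁ ℓ x₃ y₃ : K} (h₁ : W.Nonsingular x₁ y₁)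
    (hd : 2 * y₁ + W.a₁ * x₁ + W.a₃ ≠ 0)
    (hℓ : ℓ * (2 * y₁ + W.a₁ * x₁ + W.a₃) = 3 * x₁ ^ 2 + 2 * W.a₂ * x₁ + W.a₄ - W.a₁ * y₁)
    (hx₃ : x₃ = ℓ ^ 2 + W.a₁ * ℓ - W.a₂ - 2 * x₁)
    (hy₃ : y₃ = -(ℓ * (x₃ - x₁) + y₁) - W.a₁ * x₃ - W.a₃) :
    ∃ h₃ : W.Nonsingular x₃ y₃, some x₁ y₁ h₁ + some x₁ y₁ h₁ = some x₃ y₃ h₃ := by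
  have hd' : y₁ - W.negY x₁ y₁ = 2 * y₁ + W.a₁ * x₁ + W.a₃ := by rw [negY]; ring
  have hy : y₁ ≠ W.negY x₁ y₁ := by rwa [← sub_ne_zero, hd']
  have hs : W.slope x₁ x₁ y₁ y₁ = ℓ := by
    rw [slope_of_Y_ne rfl hy, hd', div_eq_iff hd, hℓ]
  have hX : W.addX x₁ x₁ (W.slope x₁ x₁ y₁ y₁) = x₃ := by rw [hs, addX, hx₃]; ring
  have hY : W.addY x₁ x₁ y₁ (W.slope x₁ x₁ y₁ y₁) = y₃ := by
    rw [addY, negAddY, hX, hs, negY, hy₃]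
  have := nonsingular_add h₁ h₁ fun hxy => hy hxy.right
  rw [add_self_of_Y_ne hy]
  simp only [hX, hY] at this ⊢
  exact ⟨this, trivial⟩

/-- An affine point is killed by `2` iff the vertical line through it is tangent. -/
lemma add_self_eq_zero_iff {x y : K} (h : W.Nonsingular x y) :
    some x y h + some x y h = 0 ↔ 2 * y + W.a₁ * x + W.a₃ = 0 := by
  constructor
  · intro h0
    by_contra hd
    obtain ⟨h₃, e⟩ := exists_add_self_eq_some_of_tangent (ℓ := (3 * x ^ 2 + 2 * W.a₂ * x + W.a₄ -
      W.a₁ * y) / (2 * y + W.a₁ * x + W.a₃)) h hd (div_mul_cancel₀ _ hd) rfl rfl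
    exact some_ne_zero _ (e.symm.trans h0)
  · intro h0
    refine add_self_of_Y_eq ?_
    rw [negY]; linear_combination h0

/-- An affine point of a Weierstrass curve has order `3` iff the tangent line at it is an
inflectional tangent, stated without dividing. -/
lemma three_nsmul_eq_zero_iff {x y : K} (h : W.Nonsingular x y) :
    3 • some x y h = 0 ↔
      (3 * x ^ 2 + 2 * W.a₂ * x + W.a₄ - W.a₁ * y) ^ 2 +
        W.a₁ * (3 * x ^ 2 + 2 * W.a₂ * x + W.a₄ - W.a₁ * y) * (2 * y + W.a₁ * x + W.a₃) -
        (W.a₂ + 3 * x) * (2 * y + W.a₁ * x + W.a₃) ^ 2 = 0 := by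
  have h3 : 3 • some x y h = (some x y h + some x y h) + some x y h := by
    rw [succ_nsmul, two_nsmul]
  rw [h3]
  by_cases hd : 2 * y + W.a₁ * x + W.a₃ = 0
  · rw [(add_self_eq_zero_iff h).mpr hd, zero_add, hd]
    have hn := (nonsingular_iff' ..).mp h
    refine ⟨fun h0 => absurd h0 (some_ne_zero _), fun h0 => ?_⟩
    have h0' : 3 * x ^ 2 + 2 * W.a₂ * x + W.a₄ - W.a₁ * y = 0 := by
      simpa using h0
    rcases hn.2 with h' | h'
    · exact absurd (by linear_combination -h0') h'
    · exact absurd (by linear_combination hd) h'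
  · set N := 3 * x ^ 2 + 2 * W.a₂ * x + W.a₄ - W.a₁ * y with hN
    set D := 2 * y + W.a₁ * x + W.a₃ with hD
    have hℓ : N / D * D = N := div_mul_cancel₀ _ hd
    obtain ⟨h₃, e⟩ := exists_add_self_eq_some_of_tangent (ℓ := N / D) h hd hℓ rfl rfl
    have key : N ^ 2 + W.a₁ * N * D - (W.a₂ + 3 * x) * D ^ 2 =
        D ^ 2 * (((N / D) ^ 2 + W.a₁ * (N / D) - W.a₂ - 2 * x) - x) := by
      field_simp
      ring
    rw [key, mul_eq_zero, or_iff_right (pow_ne_zero 2 hd), sub_eq_zero, e]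
    constructor
    · intro h0
      have := eq_neg_of_add_eq_zero_left h0
      rw [neg_some, some.injEq] at this
      exact this.1
    · intro h0
      rw [add_eq_zero_iff_eq_neg, neg_some, some.injEq]
      refine ⟨h0, ?_⟩
      rw [h0, negY]; ring

end WeierstrassCurve.Affine.Point

namespace WeierstrassCurve.VariableChange

variable {K : Type*} [Field K]

lemma nonsingular_of_smul (C : VariableChange K) (W : WeierstrassCurve K) {x y : K}
    (h : (C • W).toAffine.Nonsingular x y) :
    W.toAffine.Nonsingular ((C.u : K) ^ 2 * x + C.r)
      ((C.u : K) ^ 3 * y + (C.u : K) ^ 2 * C.s * x + C.t) := by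
  have hu : (C.u : K) ≠ 0 := C.u.ne_zero
  rw [Affine.nonsingular_iff', Affine.equation_iff'] at h ⊢
  simp only [variableChange_def, Units.val_inv_eq_inv_val] at h
  obtain ⟨h, h'⟩ := h
  refine ⟨?_, ?_⟩
  · field_simp at h
    linear_combination h
  · by_contra! hc
    obtain ⟨h1, h2⟩ := hc
    rcases h' with h' | h'
    · refine h' ?_
      field_simp
      linear_combination h1 + C.s * h2
    · refine h' ?_
      field_simp
      linear_combination h2

variable [DecidableEq K]

/-- The homomorphism from the group of points of `C • W` to that of `W` given by the change of
coordinates `C`. -/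
noncomputable def pointHom (C : VariableChange K) (W : WeierstrassCurve K) :
    (C • W).toAffine.Point →+ W.toAffine.Point where
  toFun P := match P with
    | 0 => 0
    | .some _ _ h => .some _ _ (C.nonsingular_of_smul W h)
  map_zero' := rfl
  map_add' := by
    have hu : (C.u : K) ≠ 0 := C.u.ne_zero
    rintro (_ | ⟨x₁, y₁, h₁⟩) (_ | ⟨x₂, y₂, h₂⟩)
    any_goals rfl
    by_cases hx : x₁ = x₂
    · subst hx
      rcases Affine.Y_eq_of_X_eq h₁.1 h₂.1 rfl with hy | hy
      · subst hy
        by_cases hd : 2 * y₁ + (C • W).a₁ * x₁ + (C • W).a₃ = 0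
        · have h0 := (Affine.Point.add_self_eq_zero_iff h₁).mpr hd
          rw [h0]
          refine ((Affine.Point.add_self_eq_zero_iff _).mpr ?_).symm
          simp only [variableChange_def, Units.val_inv_eq_inv_val] at hd
          field_simp at hd
          linear_combination hd
        · have hN : ∀ N D : K, D ≠ 0 → N / D * D = N := fun N D h => div_mul_cancel₀ _ h
          obtain ⟨ℓ, hℓ⟩ : ∃ ℓ : K, ℓ * (2 * y₁ + (C • W).a₁ * x₁ + (C • W).a₃) =
            3 * x₁ ^ 2 + 2 * (C • W).a₂ * x₁ + (C • W).a₄ - (C • W).a₁ * y₁ :=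
            ⟨_, hN _ _ hd⟩
          obtain ⟨h₃, e⟩ := Affine.Point.exists_add_self_eq_some_of_tangent h₁ hd hℓ rfl rfl
          rw [e]
          obtain ⟨h₄, e'⟩ := Affine.Point.exists_add_self_eq_some_of_tangent
            (C.nonsingular_of_smul W h₁) (ℓ := C.u * ℓ + C.s)
            (x₃ := (C.u : K) ^ 2 * (ℓ ^ 2 + (C • W).a₁ * ℓ - (C • W).a₂ - 2 * x₁) + C.r)
            (y₃ := (C.u : K) ^ 3 * (-(ℓ * ((ℓ ^ 2 + (C • W).a₁ * ℓ - (C • W).a₂ - 2 * x₁) - x₁)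
              + y₁) - (C • W).a₁ * (ℓ ^ 2 + (C • W).a₁ * ℓ - (C • W).a₂ - 2 * x₁) - (C • W).a₃) +
              (C.u : K) ^ 2 * C.s * (ℓ ^ 2 + (C • W).a₁ * ℓ - (C • W).a₂ - 2 * x₁) + C.t)
            (by
              contrapose! hd
              simp only [variableChange_def, Units.val_inv_eq_inv_val]
              field_simp
              linear_combination hd)
            (by
              simp only [variableChange_def, Units.val_inv_eq_inv_val] at hℓ
              field_simp at hℓ
              linear_combination hℓ)
            (by
              simp only [variableChange_def, Units.val_inv_eq_inv_val]
              field_simp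
              ring)
            (by
              simp only [variableChange_def, Units.val_inv_eq_inv_val]
              field_simp
              ring)
          exact e'.symm
      · have hl : Affine.Point.some x₁ y₁ h₁ + Affine.Point.some x₁ y₂ h₂ = 0 :=
          Affine.Point.add_of_Y_eq rfl hy
        rw [hl]
        refine (Affine.Point.add_of_Y_eq rfl ?_).symm
        rw [hy]
        simp only [Affine.negY, variableChange_def, Units.val_inv_eq_inv_val]
        field_simp
        ring
    · obtain ⟨ℓ, hℓ⟩ : ∃ ℓ : K, ℓ * (x₁ - x₂) = y₁ - y₂ :=
        ⟨(y₁ - y₂) / (x₁ - x₂), div_mul_cancel₀ _ (sub_ne_zero.mpr hx)⟩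
      obtain ⟨h₃, e⟩ := Affine.Point.exists_add_eq_some_of_chord h₁ h₂ hx hℓ rfl rfl
      rw [e]
      obtain ⟨h₄, e'⟩ := Affine.Point.exists_add_eq_some_of_chord
        (C.nonsingular_of_smul W h₁) (C.nonsingular_of_smul W h₂) (ℓ := C.u * ℓ + C.s)
        (x₃ := (C.u : K) ^ 2 * (ℓ ^ 2 + (C • W).a₁ * ℓ - (C • W).a₂ - x₁ - x₂) + C.r)
        (y₃ := (C.u : K) ^ 3 * (-(ℓ * ((ℓ ^ 2 + (C • W).a₁ * ℓ - (C • W).a₂ - x₁ - x₂) - x₁)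
          + y₁) - (C • W).a₁ * (ℓ ^ 2 + (C • W).a₁ * ℓ - (C • W).a₂ - x₁ - x₂) - (C • W).a₃) +
          (C.u : K) ^ 2 * C.s * (ℓ ^ 2 + (C • W).a₁ * ℓ - (C • W).a₂ - x₁ - x₂) + C.t)
        (by
          intro h
          refine hx (mul_left_cancel₀ (pow_ne_zero 2 hu) ?_)
          linear_combination h)
        (by linear_combination (C.u : K) ^ 3 * hℓ)
        (by
          simp only [variableChange_def, Units.val_inv_eq_inv_val]
          field_simp
          ring)
        (by
          simp only [variableChange_def, Units.val_inv_eq_inv_val]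
          field_simp
          ring)
      exact e'.symm

lemma pointHom_some (C : VariableChange K) (W : WeierstrassCurve K) {x y : K}
    (h : (C • W).toAffine.Nonsingular x y) :
    C.pointHom W (.some x y h) = .some _ _ (C.nonsingular_of_smul W h) := rfl

lemma pointHom_injective (C : VariableChange K) (W : WeierstrassCurve K) :
    Function.Injective (C.pointHom W) := by
  have hu : (C.u : K) ≠ 0 := C.u.ne_zero
  refine (injective_iff_map_eq_zero _).mpr ?_
  rintro (_ | ⟨x, y, h⟩) h0
  · rfl
  · exact absurd h0 (Affine.Point.some_ne_zero _)

/-- A change of coordinates preserves the order of points. -/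
lemma addOrderOf_some (C : VariableChange K) (W : WeierstrassCurve K) {x y : K}
    (h : (C • W).toAffine.Nonsingular x y) :
    addOrderOf (Affine.Point.some x y h) =
      addOrderOf (Affine.Point.some _ _ (C.nonsingular_of_smul W h)) := by
  rw [← pointHom_some, addOrderOf_injective _ (C.pointHom_injective W)]

end WeierstrassCurve.VariableChange

/-! ### The Tate normal form of a point of order 15 -/

open WeierstrassCurve WeierstrassCurve.Affine

/-- The Tate normal form `y² + (1 - c)xy - by = x³ - bx²`, whose marked point is `(0, 0)`. -/
def tateCurve {K : Type*} [Field K] (b c : K) : WeierstrassCurve K := ⟨1 - c, -b, -b, 0, 0⟩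

/-- The plane equation of `X₁(15)` in the coordinates `r = b / c`, `s = c² / (b - c)` on the
family of Tate normal forms. -/
def levelFifteenPolynomial {K : Type*} [Field K] (r s : K) : K :=
  -r ^ 3 + r ^ 2 * (s ^ 5 - 7 * s ^ 4 + 18 * s ^ 3 - 19 * s ^ 2 + 10 * s) +
    r * (s ^ 5 - 4 * s ^ 4 + 5 * s ^ 2 - 5 * s) + s ^ 5 - s ^ 4 + s ^ 3 - s ^ 2 + s

section TateNormalForm

variable {K : Type*} [Field K]

namespace WeierstrassCurve

/-- The numerator of the slope of the tangent line at `(x, y)`. -/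
def tangentNum (W : WeierstrassCurve K) (x y : K) : K :=
  3 * x ^ 2 + 2 * W.a₂ * x + W.a₄ - W.a₁ * y

/-- The denominator of the slope of the tangent line at `(x, y)`; it is also the coefficient
`a₃` after `(x, y)` is moved to the origin. -/
def tangentDen (W : WeierstrassCurve K) (x y : K) : K := 2 * y + W.a₁ * x + W.a₃

/-- The coefficient `a₁` after `(x, y)` is moved to the origin and its tangent line to `y = 0`. -/
def tangentA₁ (W : WeierstrassCurve K) (x y : K) : K :=
  W.a₁ + 2 * (W.tangentNum x y / W.tangentDen x y)

/-- The coefficient `a₂` after `(x, y)` is moved to the origin and its tangent line to `y = 0`. -/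
def tangentA₂ (W : WeierstrassCurve K) (x y : K) : K :=
  W.a₂ + 3 * x - (W.tangentNum x y / W.tangentDen x y) * W.a₁ -
    (W.tangentNum x y / W.tangentDen x y) ^ 2

/-- The parameter `b` of the Tate normal form of the pair `(W, (x, y))`. -/
def tateB (W : WeierstrassCurve K) (x y : K) : K :=
  -W.tangentA₂ x y ^ 3 / W.tangentDen x y ^ 2

/-- The parameter `c` of the Tate normal form of the pair `(W, (x, y))`. -/
def tateC (W : WeierstrassCurve K) (x y : K) : K :=
  1 - W.tangentA₁ x y * W.tangentA₂ x y / W.tangentDen x y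

/-- A pair whose marked point has order neither `2` nor `3` is isomorphic to its Tate normal
form. -/
lemma exists_smul_eq_tateCurve (W : WeierstrassCurve K) {x y : K} (h : W.toAffine.Equation x y)
    (h2 : W.tangentDen x y ≠ 0) (h3 : W.tangentA₂ x y ≠ 0) :
    ∃ C : VariableChange K, C • W = tateCurve (W.tateB x y) (W.tateC x y) ∧
      C.r = x ∧ C.t = y := by
  refine ⟨⟨Units.mk0 (W.tangentDen x y / W.tangentA₂ x y) (div_ne_zero h2 h3), x,
    W.tangentNum x y / W.tangentDen x y, y⟩, ?_, rfl, rfl⟩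
  have e := (equation_iff' ..).mp h
  rw [variableChange_def, tateCurve]
  simp only [Units.val_inv_eq_inv_val, Units.val_mk0, tateB, tateC]
  have hl : W.tangentNum x y / W.tangentDen x y * W.tangentDen x y = W.tangentNum x y :=
    div_mul_cancel₀ _ h2
  ext <;> dsimp only
  · rw [tangentA₁]; field_simp; ring
  · have : W.a₂ - W.tangentNum x y / W.tangentDen x y * W.a₁ + 3 * x -
        (W.tangentNum x y / W.tangentDen x y) ^ 2 = W.tangentA₂ x y := by rw [tangentA₂]; ring
    rw [this]; field_simp
  · have : W.a₃ + x * W.a₁ + 2 * y = W.tangentDen x y := by rw [tangentDen]; ring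
    rw [this]; field_simp
  · rw [mul_eq_zero]; right
    rw [tangentNum, tangentDen] at hl
    rw [tangentNum, tangentDen]
    linear_combination -hl
  · rw [mul_eq_zero]; right
    linear_combination -e

section Invariance

variable (C : VariableChange K) (W : WeierstrassCurve K) (x y : K)

lemma tangentDen_smul : (C • W).tangentDen x y = (C.u : K)⁻¹ ^ 3 *
    W.tangentDen ((C.u : K) ^ 2 * x + C.r) ((C.u : K) ^ 3 * y + (C.u : K) ^ 2 * C.s * x + C.t) := by
  have hu : (C.u : K) ≠ 0 := C.u.ne_zero
  simp only [tangentDen, variableChange_def, Units.val_inv_eq_inv_val]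
  field_simp; ring

lemma tangentNum_smul : (C • W).tangentNum x y = (C.u : K)⁻¹ ^ 4 *
    (W.tangentNum ((C.u : K) ^ 2 * x + C.r) ((C.u : K) ^ 3 * y + (C.u : K) ^ 2 * C.s * x + C.t) -
    C.s * W.tangentDen ((C.u : K) ^ 2 * x + C.r)
      ((C.u : K) ^ 3 * y + (C.u : K) ^ 2 * C.s * x + C.t)) := by
  have hu : (C.u : K) ≠ 0 := C.u.ne_zero
  simp only [tangentDen, tangentNum, variableChange_def, Units.val_inv_eq_inv_val]
  field_simp; ring

lemma tateB_smul (h : (C • W).tangentDen x y ≠ 0) : (C • W).tateB x y =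
    W.tateB ((C.u : K) ^ 2 * x + C.r) ((C.u : K) ^ 3 * y + (C.u : K) ^ 2 * C.s * x + C.t) ∧
    (C • W).tateC x y =
    W.tateC ((C.u : K) ^ 2 * x + C.r) ((C.u : K) ^ 3 * y + (C.u : K) ^ 2 * C.s * x + C.t) := by
  have hu : (C.u : K) ≠ 0 := C.u.ne_zero
  rw [tangentDen_smul] at h
  have hD := right_ne_zero_of_mul h
  simp only [tateB, tateC, tangentA₁, tangentA₂, tangentDen_smul, tangentNum_smul]
  generalize W.tangentNum ((C.u : K) ^ 2 * x + C.r)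
    ((C.u : K) ^ 3 * y + (C.u : K) ^ 2 * C.s * x + C.t) = N at *
  generalize W.tangentDen ((C.u : K) ^ 2 * x + C.r)
    ((C.u : K) ^ 3 * y + (C.u : K) ^ 2 * C.s * x + C.t) = D at *
  simp only [variableChange_def, Units.val_inv_eq_inv_val]
  have hl : (C.u : K)⁻¹ ^ 4 * (N - C.s * D) / ((C.u : K)⁻¹ ^ 3 * D) =
      (C.u : K)⁻¹ * (N / D - C.s) := by field_simp
  rw [hl]
  generalize N / D = l
  constructor
  · field_simp; ring
  · field_simp; ring

end Invariance

end WeierstrassCurve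

lemma tateCurve_nonsingular_zero {b c : K} (hb : b ≠ 0) :
    (tateCurve b c).toAffine.Nonsingular 0 0 := by
  rw [nonsingular_zero]
  simp [tateCurve, hb]

variable [DecidableEq K]

lemma WeierstrassCurve.tangentDen_ne_zero_of_addOrderOf {W : WeierstrassCurve K} {x y : K}
    (h : W.toAffine.Nonsingular x y) (ho : addOrderOf (Point.some x y h) = 15) :
    W.tangentDen x y ≠ 0 ∧ W.tangentA₂ x y ≠ 0 := by
  have h2 : W.tangentDen x y ≠ 0 := by
    intro h0
    have := (Point.add_self_eq_zero_iff h).mpr h0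
    rw [← two_nsmul, ← addOrderOf_dvd_iff_nsmul_eq_zero, ho] at this
    norm_num at this
  refine ⟨h2, fun h0 => ?_⟩
  have : 3 • Point.some x y h = 0 := by
    rw [Point.three_nsmul_eq_zero_iff]
    change W.tangentNum x y ^ 2 + W.a₁ * W.tangentNum x y * W.tangentDen x y -
      (W.a₂ + 3 * x) * W.tangentDen x y ^ 2 = 0
    have e : W.tangentNum x y / W.tangentDen x y * W.tangentDen x y = W.tangentNum x y :=
      div_mul_cancel₀ _ h2
    rw [tangentA₂] at h0
    generalize W.tangentNum x y / W.tangentDen x y = l at *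
    rw [← e]
    linear_combination -W.tangentDen x y ^ 2 * h0
  rw [← addOrderOf_dvd_iff_nsmul_eq_zero, ho] at this
  norm_num at this

lemma tateCurve_four_nsmul {b c : K} (hb : b ≠ 0) (hc : c ≠ 0)
    (h : (tateCurve b c).toAffine.Nonsingular 0 0) :
    ∃ h₄, 4 • Point.some 0 0 h = Point.some (W' := (tateCurve b c).toAffine) (b / c * (b / c - 1))
      ((b / c) ^ 2 * (c - b / c + 1)) h₄ := by
  obtain ⟨h₂, e₂⟩ := Point.exists_add_self_eq_some_of_tangent (ℓ := 0) (x₃ := b) (y₃ := b * c) h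
    (by simp [tateCurve, hb]) (by simp [tateCurve]) (by simp [tateCurve])
    (by simp only [tateCurve]; ring)
  obtain ⟨h₄, e₄⟩ := Point.exists_add_self_eq_some_of_tangent (ℓ := b / c - 1 + c)
    (x₃ := b / c * (b / c - 1)) (y₃ := (b / c) ^ 2 * (c - b / c + 1)) h₂
    (by
      have : 2 * (b * c) + (tateCurve b c).a₁ * b + (tateCurve b c).a₃ = b * c := by
        simp only [tateCurve]; ring
      rw [this]; exact mul_ne_zero hb hc)
    (by simp only [tateCurve]; field_simp; ring) (by simp only [tateCurve]; field_simp; ring)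
    (by simp only [tateCurve]; field_simp; ring)
  refine ⟨h₄, ?_⟩
  rw [← e₄, ← e₂, ← two_nsmul, ← two_nsmul, ← mul_nsmul]

lemma tateCurve_five_nsmul {r s : K} (hr : r ≠ 0) (hr1 : r - 1 ≠ 0) (hs : s ≠ 0)
    (h : (tateCurve (r * s * (r - 1)) (s * (r - 1))).toAffine.Nonsingular 0 0) :
    ∃ h₅, 5 • Point.some 0 0 h =
      Point.some (W' := (tateCurve (r * s * (r - 1)) (s * (r - 1))).toAffine) (r * s * (s - 1)) (r * s ^ 2 * (r - s)) h₅ := by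
  have hc : s * (r - 1) ≠ 0 := mul_ne_zero hs hr1
  obtain ⟨h₄, e₄⟩ := tateCurve_four_nsmul (mul_ne_zero (mul_ne_zero hr hs) hr1) hc h
  have e : r * s * (r - 1) / (s * (r - 1)) = r := by field_simp
  obtain ⟨h₅, e₅⟩ := Point.exists_add_eq_some_of_chord (ℓ := r * (s - 1)) (x₃ := r * s * (s - 1))
    (y₃ := r * s ^ 2 * (r - s)) h₄ h (by rw [e]; exact mul_ne_zero hr hr1)
    (by rw [e]; ring) (by rw [e]; simp only [tateCurve]; ring)
    (by rw [e]; simp only [tateCurve]; ring)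
  refine ⟨h₅, ?_⟩
  rw [← e₅, ← e₄, succ_nsmul]

lemma tateCurve_fifteen_nsmul_eq_zero_iff {r s : K} (hr : r ≠ 0) (hr1 : r - 1 ≠ 0) (hs : s ≠ 0)
    (h : (tateCurve (r * s * (r - 1)) (s * (r - 1))).toAffine.Nonsingular 0 0) :
    15 • Point.some 0 0 h = 0 ↔ levelFifteenPolynomial r s = 0 := by
  obtain ⟨h₅, e₅⟩ := tateCurve_five_nsmul hr hr1 hs h
  rw [show 15 = 5 * 3 from rfl, mul_nsmul, e₅, Point.three_nsmul_eq_zero_iff]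
  have h0 : r ^ 3 * s ^ 3 ≠ 0 := mul_ne_zero (pow_ne_zero 3 hr) (pow_ne_zero 3 hs)
  rw [← or_iff_right (b := levelFifteenPolynomial r s = 0) h0, ← mul_eq_zero,
    ← neg_eq_zero (a := _ * levelFifteenPolynomial r s)]
  refine Eq.congr_left ?_
  simp only [tateCurve, levelFifteenPolynomial]
  ring

/-- If the marked point of a Tate normal form has order `15`, the parameters `r`, `s` are
nondegenerate and lie on the plane model of `X₁(15)`. -/
lemma tateCurve_of_addOrderOf {b c : K} (hb : b ≠ 0)
    (h : (tateCurve b c).toAffine.Nonsingular 0 0) (ho : addOrderOf (Point.some 0 0 h) = 15) :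
    ∃ r s : K, r ≠ 0 ∧ r - 1 ≠ 0 ∧ s ≠ 0 ∧ s - 1 ≠ 0 ∧ b = r * s * (r - 1) ∧ c = s * (r - 1) ∧
      levelFifteenPolynomial r s = 0 := by
  have hn : ∀ n : ℕ, n • Point.some 0 0 h = 0 → 15 ∣ n := fun n hn0 => by
    rwa [← ho, addOrderOf_dvd_iff_nsmul_eq_zero]
  have hx : ∀ (n : ℕ) (y : K) (hy),
      n • Point.some 0 0 h = Point.some (W' := (tateCurve b c).toAffine) 0 y hy →
      15 ∣ n + 1 ∨ 15 ∣ n + 14 := fun n y hy e => by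
    rcases (Point.X_eq_iff (h₁ := hy) (h₂ := h)).mp rfl with e' | e'
    · right
      apply hn
      rw [add_nsmul, e, e', ← succ_nsmul', show 14 + 1 = 15 from rfl, ← ho,
        addOrderOf_nsmul_eq_zero]
    · left
      apply hn
      rw [succ_nsmul, e, e', neg_add_cancel]
  have hc : c ≠ 0 := by
    intro h0
    obtain ⟨h₂, e₂⟩ := Point.exists_add_self_eq_some_of_tangent (ℓ := 0) (x₃ := b) (y₃ := b * c) h
      (by simp [tateCurve, hb]) (by simp [tateCurve]) (by simp [tateCurve])
      (by simp only [tateCurve]; ring)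
    have := (Point.add_self_eq_zero_iff h₂).mpr (by simp only [tateCurve, h0]; ring)
    rw [← e₂, ← two_nsmul, ← two_nsmul, ← mul_nsmul] at this
    have := hn _ this
    norm_num at this
  obtain ⟨h₄, e₄⟩ := tateCurve_four_nsmul hb hc h
  have hr : b / c ≠ 0 := div_ne_zero hb hc
  have hr1 : b / c - 1 ≠ 0 := by
    intro h0
    have e0 : b / c * (b / c - 1) = 0 := by rw [h0, mul_zero]
    simp only [e0] at e₄ h₄
    have := hx 4 _ _ e₄
    norm_num at this
  have hs : c / (b / c - 1) ≠ 0 := div_ne_zero hc hr1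
  have hb' : b = b / c * (c / (b / c - 1)) * (b / c - 1) := by
    rw [mul_assoc, div_mul_cancel₀ _ hr1, div_mul_cancel₀ _ hc]
  have hc' : c = (c / (b / c - 1)) * (b / c - 1) := by
    rw [div_mul_cancel₀ _ hr1]
  refine ⟨b / c, c / (b / c - 1), hr, hr1, hs, ?_, hb', hc', ?_⟩
  all_goals
    generalize b / c = r at *
    generalize c / (r - 1) = s at *
    subst hb' hc'
  · intro h0
    obtain ⟨h₅, e₅⟩ := tateCurve_five_nsmul hr hr1 hs h
    have e0 : r * s * (s - 1) = 0 := by rw [h0, mul_zero]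
    simp only [e0] at e₅ h₅
    have := hx 5 _ _ e₅
    norm_num at this
  · rw [← tateCurve_fifteen_nsmul_eq_zero_iff hr hr1 hs h, ← ho, addOrderOf_nsmul_eq_zero]

lemma tateCurve_addOrderOf {r s : K} (hr : r ≠ 0) (hr1 : r - 1 ≠ 0) (hs : s ≠ 0)
    (h : (tateCurve (r * s * (r - 1)) (s * (r - 1))).toAffine.Nonsingular 0 0)
    (h0 : levelFifteenPolynomial r s = 0) : addOrderOf (Point.some 0 0 h) = 15 := by
  have h15 := (tateCurve_fifteen_nsmul_eq_zero_iff hr hr1 hs h).mpr h0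
  have h5 : ¬ addOrderOf (Point.some 0 0 h) ∣ 5 := by
    rw [addOrderOf_dvd_iff_nsmul_eq_zero]
    obtain ⟨h₅, e₅⟩ := tateCurve_five_nsmul hr hr1 hs h
    rw [e₅]; exact Point.some_ne_zero _
  have h3 : ¬ addOrderOf (Point.some 0 0 h) ∣ 3 := by
    rw [addOrderOf_dvd_iff_nsmul_eq_zero, Point.three_nsmul_eq_zero_iff]
    have : r * s * (r - 1) ≠ 0 := mul_ne_zero (mul_ne_zero hr hs) hr1
    simpa [tateCurve] using this
  rw [← addOrderOf_dvd_iff_nsmul_eq_zero] at h15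
  have hmem : addOrderOf (Point.some 0 0 h) ∈ Nat.divisors 15 := by simpa using h15
  rw [show Nat.divisors 15 = {1, 3, 5, 15} from rfl] at hmem
  simp only [Finset.mem_insert, Finset.mem_singleton] at hmem
  rcases hmem with e | e | e | e
  · rw [e] at h5; norm_num at h5
  · rw [e] at h3; norm_num at h3
  · rw [e] at h5; norm_num at h5
  · exact e

end TateNormalForm

/-! ### The elliptic curve birational to the plane model -/

/-- The elliptic curve `y² + xy + y = x³ + x²`, a Weierstrass model of `X₁(15)`. -/
def modelX₁Fifteen : WeierstrassCurve ℚ := ⟨1, 1, 1, 0, 0⟩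

instance modelX₁Fifteen_isElliptic : modelX₁Fifteen.IsElliptic := by
  refine ⟨isUnit_iff_ne_zero.mpr ?_⟩
  norm_num [modelX₁Fifteen, WeierstrassCurve.Δ, WeierstrassCurve.b₂, WeierstrassCurve.b₄,
    WeierstrassCurve.b₆, WeierstrassCurve.b₈]

section PlaneModel

variable {K : Type*} [Field K]

lemma modelX₁Fifteen_nonsingular_iff [Algebra ℚ K] (x y : K) :
    (modelX₁Fifteen.baseChange K).toAffine.Nonsingular x y ↔
      y ^ 2 + x * y + y = x ^ 3 + x ^ 2 := by
  have : (modelX₁Fifteen.baseChange K).IsElliptic :=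
    inferInstanceAs (modelX₁Fifteen.map (algebraMap ℚ K)).IsElliptic
  rw [← equation_iff_nonsingular (W := modelX₁Fifteen.baseChange K), equation_iff]
  simp [WeierstrassCurve.baseChange, WeierstrassCurve.map, modelX₁Fifteen]

/-- The `x`-coordinate on `y² + xy + y = x³ + x²` in terms of the coordinates `r`, `s`. -/
def planeToX (r s : K) : K := (r - s) * (1 - s) / (s * (1 - 2 * r + r * s))

/-- The `y`-coordinate on `y² + xy + y = x³ + x²` in terms of the coordinate `s`. -/
def planeToY (s : K) : K := (1 - s) / s

variable {r s : K}

lemma levelFifteen_denominator_ne_zero (hr : r ≠ 0) (hr1 : r - 1 ≠ 0)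
    (h0 : levelFifteenPolynomial r s = 0) : 1 - 2 * r + r * s ≠ 0 := by
  intro h
  have hs : s = (2 * r - 1) / r := by field_simp; linear_combination h
  rw [levelFifteenPolynomial, hs] at h0
  field_simp at h0
  exact pow_ne_zero 8 hr1 (by linear_combination -h0)

lemma planeTo_equation (hs : s ≠ 0) (hd : 1 - 2 * r + r * s ≠ 0)
    (h0 : levelFifteenPolynomial r s = 0) :
    planeToY s ^ 2 + planeToX r s * planeToY s + planeToY s =
      planeToX r s ^ 3 + planeToX r s ^ 2 := by
  rw [levelFifteenPolynomial] at h0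
  rw [planeToX, planeToY]
  obtain ⟨D, hD⟩ : ∃ D, D = 1 - 2 * r + r * s := ⟨_, rfl⟩
  rw [← hD] at hd ⊢
  field_simp
  rw [hD]
  linear_combination (-(s - 1)) * h0

lemma planeToY_add_one (hs : s ≠ 0) : planeToY s + 1 = s⁻¹ := by
  rw [planeToY]; field_simp; ring

/-- The coordinate `r` is a rational function of the coordinates `x` and `y`. -/
lemma planeTo_left_inv (hs : s ≠ 0) (hs1 : s - 1 ≠ 0) (hd : 1 - 2 * r + r * s ≠ 0) :
    r = (planeToX r s + planeToY s + planeToX r s * planeToY s) /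
      (planeToY s + planeToY s ^ 2 + planeToX r s + 2 * planeToX r s * planeToY s) := by
  obtain ⟨D, hD⟩ : ∃ D, D = 1 - 2 * r + r * s := ⟨_, rfl⟩
  have hd' := hD ▸ hd
  have e : planeToY s + planeToY s ^ 2 + planeToX r s + 2 * planeToX r s * planeToY s =
      -(s - 1) ^ 3 / (s ^ 2 * (1 - 2 * r + r * s)) := by
    rw [planeToX, planeToY, ← hD]; field_simp; rw [hD]; ring
  rw [eq_div_iff (by
    rw [e]
    exact div_ne_zero (neg_ne_zero.mpr (pow_ne_zero 3 hs1)) (mul_ne_zero (pow_ne_zero 2 hs) hd))]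
  rw [planeToX, planeToY, ← hD]; rw [← hD] at hd; field_simp; rw [hD]; ring

/-- A nonzero polynomial vanishing at the `x`-coordinates of all cusps of `X₁(15)`. -/
def cuspPolynomial (x : K) : K :=
  x * (x + 1) * (x ^ 2 + x + 1) * (x ^ 4 + 3 * x ^ 3 + 4 * x ^ 2 + 2 * x + 1) *
    (x ^ 4 - 7 * x ^ 3 - 6 * x ^ 2 + 2 * x + 1)

lemma levelFifteenPolynomial_div_inv {n d t : K} (hd : d ≠ 0) (ht : t ≠ 0) :
    levelFifteenPolynomial (n / d) t⁻¹ =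
      (-n ^ 3 * t ^ 5 + n ^ 2 * d * (1 - 7 * t + 18 * t ^ 2 - 19 * t ^ 3 + 10 * t ^ 4) +
        n * d ^ 2 * (1 - 4 * t + 5 * t ^ 3 - 5 * t ^ 4) +
        d ^ 3 * (1 - t + t ^ 2 - t ^ 3 + t ^ 4)) / (d ^ 3 * t ^ 5) := by
  rw [levelFifteenPolynomial]; field_simp; ring

lemma tateCurve_Δ (r s : K) : (tateCurve (r * s * (r - 1)) (s * (r - 1))).Δ =
    r ^ 3 * s ^ 4 * (r - 1) ^ 5 * (r ^ 2 * s ^ 3 - 8 * r ^ 2 * s ^ 2 + 16 * r ^ 2 * s -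
      2 * r * s ^ 3 + 5 * r * s ^ 2 - 20 * r * s + s ^ 3 + 3 * s ^ 2 + 3 * s + 1) := by
  simp only [tateCurve, WeierstrassCurve.Δ, WeierstrassCurve.b₂, WeierstrassCurve.b₄,
    WeierstrassCurve.b₆, WeierstrassCurve.b₈]
  ring

lemma planeToX_div_inv {n d t : K} (hd : d ≠ 0) (ht : t ≠ 0) (h : d * t - 2 * n * t + n ≠ 0) :
    planeToX (n / d) t⁻¹ = (n * t - d) * (t - 1) / (d * t - 2 * n * t + n) := by
  have e : 1 - 2 * (n / d) + n / d * t⁻¹ = (d * t - 2 * n * t + n) / (d * t) := by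
    field_simp
  obtain ⟨D, hD⟩ : ∃ D, D = d * t - 2 * n * t + n := ⟨_, rfl⟩
  rw [← hD] at h
  rw [planeToX, e, ← hD]
  field_simp

/-- Away from the cusps a point `(x, y)` of the elliptic curve gives a point `(r, s)` of the plane
model whose Tate normal form is nonsingular. -/
lemma exists_plane_of_equation {x y : K} (h : y ^ 2 + x * y + y = x ^ 3 + x ^ 2)
    (hx : cuspPolynomial x ≠ 0) :
    ∃ r s : K, r ≠ 0 ∧ r - 1 ≠ 0 ∧ s ≠ 0 ∧ s - 1 ≠ 0 ∧ levelFifteenPolynomial r s = 0 ∧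
      (tateCurve (r * s * (r - 1)) (s * (r - 1))).Δ ≠ 0 ∧ x = planeToX r s ∧ y = planeToY s := by
  simp only [cuspPolynomial, mul_ne_zero_iff] at hx
  obtain ⟨⟨⟨⟨hx0, hx1⟩, hx2⟩, hx3⟩, hx4⟩ := hx
  -- Each function below has norm (over the `x`-line) a product of factors of the cusp polynomial.
  have hden : x * (x ^ 2 + x + y + 1) ≠ 0 := by
    refine mul_ne_zero hx0 fun e => pow_ne_zero 4 hx0 ?_
    linear_combination (x ^ 2 - y) * e + h
  have hnum : x + y + x * y ≠ 0 := fun e => mul_ne_zero hx0 hx3 (by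
    linear_combination -(-(1 + x) * (y + x + 1) + x) * e - (x + 1) ^ 2 * h)
  have hdif : x + y + x * y - x * (x ^ 2 + x + y + 1) ≠ 0 := fun e =>
    mul_ne_zero (mul_ne_zero (pow_ne_zero 3 hx0) hx1) hx2 (by
      linear_combination (-x ^ 3 - x ^ 2 - y - x - 1) * e + h)
  have ht : y + 1 ≠ 0 := fun e => mul_ne_zero hx0 hx2 (by
    linear_combination (y + x) * e - h)
  have hy : y ≠ 0 := fun e => mul_ne_zero (pow_ne_zero 2 hx0) hx1 (by
    linear_combination (y + x + 1) * e - h)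
  set n := x + y + x * y with hn
  set d := x * (x ^ 2 + x + y + 1) with hd
  have hden2 : d * (y + 1) - 2 * n * (y + 1) + n ≠ 0 := by
    intro e
    have e' : -x ^ 4 + x ^ 3 * y - 2 * x ^ 3 + 2 * x ^ 2 * y - x ^ 2 + 2 * x * y + y = 0 := by
      rw [hd, hn] at e
      linear_combination e + (2 + x) * h
    refine mul_ne_zero (pow_ne_zero 6 hx0) (pow_ne_zero 3 hx1) ?_
    linear_combination ((x ^ 3 + 2 * x ^ 2 + 2 * x + 1) * (y + x + 1) - (-x ^ 4 - 2 * x ^ 3 - x ^ 2))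
      * e' - (x ^ 3 + 2 * x ^ 2 + 2 * x + 1) ^ 2 * h
  have hd0 : d ≠ 0 := hden
  refine ⟨n / d, (y + 1)⁻¹, div_ne_zero hnum hden, ?_, inv_ne_zero ht, ?_, ?_, ?_, ?_, ?_⟩
  · rw [div_sub_one hden]; exact div_ne_zero hdif hden
  · rw [sub_ne_zero, Ne, inv_eq_one, add_eq_right]; exact hy
  · rw [levelFifteenPolynomial_div_inv hd0 ht, div_eq_zero_iff]
    left
    rw [hd, hn]
    linear_combination (-x ^ 6 * y ^ 4 - 3 * x ^ 6 * y ^ 3 - 4 * x ^ 6 * y ^ 2 - 2 * x ^ 6 * y -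
      x ^ 6 - 2 * x ^ 5 * y ^ 4 - 6 * x ^ 5 * y ^ 3 - 8 * x ^ 5 * y ^ 2 - 4 * x ^ 5 * y -
      2 * x ^ 5 + x ^ 4 * y ^ 5 + 4 * x ^ 4 * y ^ 4 + 2 * x ^ 4 * y ^ 3 - x ^ 4 - x ^ 3 * y ^ 6 +
      2 * x ^ 3 * y ^ 5 + 13 * x ^ 3 * y ^ 4 + 14 * x ^ 3 * y ^ 3 + 10 * x ^ 3 * y ^ 2 +
      4 * x ^ 3 * y - 3 * x ^ 2 * y ^ 6 + 7 * x ^ 2 * y ^ 4 + 7 * x ^ 2 * y ^ 3 +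
      5 * x ^ 2 * y ^ 2 + 2 * x ^ 2 * y - 3 * x * y ^ 6 - 4 * x * y ^ 5 - 6 * x * y ^ 4 -
      6 * x * y ^ 3 - 2 * x * y ^ 2 - y ^ 6 - 4 * y ^ 5 - 6 * y ^ 4 - 4 * y ^ 3 - y ^ 2) * h
  · rw [tateCurve_Δ]
    refine mul_ne_zero (mul_ne_zero (mul_ne_zero (pow_ne_zero 3 (div_ne_zero hnum hden))
      (pow_ne_zero 4 (inv_ne_zero ht))) (pow_ne_zero 5 ?_)) fun e => ?_
    · rw [div_sub_one hden]; exact div_ne_zero hdif hden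
    have e' : n ^ 2 * (1 - 8 * (y + 1) + 16 * (y + 1) ^ 2) +
        n * d * (-2 + 5 * (y + 1) - 20 * (y + 1) ^ 2) +
        d ^ 2 * (1 + 3 * (y + 1) + 3 * (y + 1) ^ 2 + (y + 1) ^ 3) = 0 := by
      generalize y + 1 = t at ht e
      have hc : n ^ 2 * (1 - 8 * t + 16 * t ^ 2) + n * d * (-2 + 5 * t - 20 * t ^ 2) +
        d ^ 2 * (1 + 3 * t + 3 * t ^ 2 + t ^ 3) = d ^ 2 * t ^ 3 * ((n / d) ^ 2 * t⁻¹ ^ 3 -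
        8 * (n / d) ^ 2 * t⁻¹ ^ 2 + 16 * (n / d) ^ 2 * t⁻¹ - 2 * (n / d) * t⁻¹ ^ 3 +
        5 * (n / d) * t⁻¹ ^ 2 - 20 * (n / d) * t⁻¹ + t⁻¹ ^ 3 + 3 * t⁻¹ ^ 2 + 3 * t⁻¹ + 1) := by
        field_simp; ring
      rw [hc, e, mul_zero]
    have e₂ : (x + 1) ^ 5 * ((x ^ 4 - 4 * x ^ 3 - 4 * x ^ 2 - 4 * x - 1) * y +
        (x ^ 5 + 3 * x ^ 4 + 4 * x ^ 3 + x ^ 2)) = 0 := by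
      rw [hd, hn] at e'
      linear_combination e' - (x ^ 7 + x ^ 6 * y + 7 * x ^ 6 + x ^ 5 * y + 22 * x ^ 5 +
        2 * x ^ 4 * y ^ 2 - 7 * x ^ 4 * y + 39 * x ^ 4 + x ^ 3 * y ^ 2 - 30 * x ^ 3 * y +
        33 * x ^ 3 + x ^ 2 * y ^ 3 + 3 * x ^ 2 * y ^ 2 - 29 * x ^ 2 * y + 17 * x ^ 2 +
        12 * x * y ^ 2 - 3 * x * y + 9 * x + 16 * y ^ 2 + 8 * y + 1) * h
    have e₃ := (mul_eq_zero.mp e₂).resolve_left (pow_ne_zero 5 hx1)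
    refine mul_ne_zero (pow_ne_zero 7 hx0) hx4 ?_
    linear_combination ((x ^ 4 - 4 * x ^ 3 - 4 * x ^ 2 - 4 * x - 1) * (y + x + 1) -
      (x ^ 5 + 3 * x ^ 4 + 4 * x ^ 3 + x ^ 2)) * e₃ -
      (x ^ 4 - 4 * x ^ 3 - 4 * x ^ 2 - 4 * x - 1) ^ 2 * h
  · rw [planeToX_div_inv hd0 ht hden2, eq_div_iff hden2, hd, hn]
    linear_combination (-(x * y + x + y)) * h
  · rw [planeToY]; field_simp; ring

end PlaneModel

/-! ### The elliptic curve as a modular curve -/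

namespace EllipticCurveWithPoint

variable {K L : Type} [Field K] [Field L]

lemma tangentDen_ne_zero (A : EllipticCurveWithPoint 15 K) :
    A.curve.tangentDen A.x A.y ≠ 0 ∧ A.curve.tangentA₂ A.x A.y ≠ 0 := by
  let := Classical.decEq K
  exact tangentDen_ne_zero_of_addOrderOf A.nonsingular A.order_eq

lemma tateB_ne_zero (A : EllipticCurveWithPoint 15 K) : A.curve.tateB A.x A.y ≠ 0 := by
  rw [tateB]
  exact div_ne_zero (neg_ne_zero.mpr (pow_ne_zero 3 A.tangentDen_ne_zero.2))
    (pow_ne_zero 2 A.tangentDen_ne_zero.1)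

/-- The coordinate `r = b / c` of a pair. -/
def planeR (A : EllipticCurveWithPoint 15 K) : K :=
  A.curve.tateB A.x A.y / A.curve.tateC A.x A.y

/-- The coordinate `s = c / (r - 1)` of a pair. -/
def planeS (A : EllipticCurveWithPoint 15 K) : K := A.curve.tateC A.x A.y / (A.planeR - 1)

lemma exists_smul_eq (A : EllipticCurveWithPoint 15 K) : ∃ C : VariableChange K,
    C • A.curve = tateCurve (A.curve.tateB A.x A.y) (A.curve.tateC A.x A.y) ∧
      C.r = A.x ∧ C.t = A.y :=
  A.curve.exists_smul_eq_tateCurve A.nonsingular.1 A.tangentDen_ne_zero.1 A.tangentDen_ne_zero.2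

lemma plane_spec (A : EllipticCurveWithPoint 15 K) :
    A.planeR ≠ 0 ∧ A.planeR - 1 ≠ 0 ∧ A.planeS ≠ 0 ∧ A.planeS - 1 ≠ 0 ∧
      A.curve.tateB A.x A.y = A.planeR * A.planeS * (A.planeR - 1) ∧
      A.curve.tateC A.x A.y = A.planeS * (A.planeR - 1) ∧
      levelFifteenPolynomial A.planeR A.planeS = 0 := by
  let := Classical.decEq K
  obtain ⟨C, hC, hr, ht⟩ := A.exists_smul_eq
  have h := tateCurve_nonsingular_zero (c := A.curve.tateC A.x A.y) A.tateB_ne_zero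
  have ho : ∀ (W : WeierstrassCurve K) (_ : C • A.curve = W) (h : W.toAffine.Nonsingular 0 0),
      addOrderOf (Point.some 0 0 h) = 15 := by
    rintro _ rfl h
    rw [C.addOrderOf_some]
    have e := A.order_eq
    convert! e using 3
    · rw [hr]; ring
    · rw [ht]; ring
  obtain ⟨r, s, hr, hr1, hs, hs1, hb, hc, h0⟩ :=
    tateCurve_of_addOrderOf A.tateB_ne_zero h (ho _ hC h)
  have hR : A.planeR = r := by rw [planeR, hb, hc]; field_simp
  have hS : A.planeS = s := by rw [planeS, hR, hc]; field_simp
  rw [hR, hS]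
  exact ⟨hr, hr1, hs, hs1, hb, hc, h0⟩

/-- Two pairs are isomorphic iff they have the same Tate normal form. -/
lemma isomorphic_iff (A B : EllipticCurveWithPoint 15 K) : A.Isomorphic B ↔
    A.curve.tateB A.x A.y = B.curve.tateB B.x B.y ∧
      A.curve.tateC A.x A.y = B.curve.tateC B.x B.y := by
  constructor
  · rintro ⟨C, hC, hx, hy⟩
    have := tateB_smul C A.curve B.x B.y (by rw [hC]; exact B.tangentDen_ne_zero.1)
    rw [hC, ← hx, ← hy] at this
    exact ⟨this.1.symm, this.2.symm⟩
  · rintro ⟨hb, hc⟩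
    obtain ⟨C, hC, hr, ht⟩ := A.exists_smul_eq
    obtain ⟨C', hC', hr', ht'⟩ := B.exists_smul_eq
    have hu' : (C'.u : K) ≠ 0 := C'.u.ne_zero
    refine ⟨C'⁻¹ * C, ?_, ?_, ?_⟩
    · rw [mul_smul, hC, hb, hc, ← hC', inv_smul_smul]
    · simp only [VariableChange.mul_def, VariableChange.inv_def, Units.val_mul,
        Units.val_inv_eq_inv_val, hr, hr']
      field_simp; ring
    · simp only [VariableChange.mul_def, VariableChange.inv_def, Units.val_mul,
        Units.val_inv_eq_inv_val, hr, hr', ht, ht']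
      field_simp; ring

lemma isomorphic_iff_plane (A B : EllipticCurveWithPoint 15 K) : A.Isomorphic B ↔
    A.planeR = B.planeR ∧ A.planeS = B.planeS := by
  rw [isomorphic_iff]
  obtain ⟨-, -, -, -, hb, hc, -⟩ := A.plane_spec
  obtain ⟨-, -, -, -, hb', hc', -⟩ := B.plane_spec
  constructor
  · rintro ⟨h₁, h₂⟩
    have : A.planeR = B.planeR := by rw [planeR, planeR, h₁, h₂]
    exact ⟨this, by rw [planeS, planeS, h₂, this]⟩
  · rintro ⟨h₁, h₂⟩
    rw [hb, hc, hb', hc', h₁, h₂]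
    exact ⟨rfl, rfl⟩

lemma IsBaseChange.plane_eq {φ : K →+* L} {A : EllipticCurveWithPoint 15 K}
    {B : EllipticCurveWithPoint 15 L} (h : IsBaseChange φ A B) :
    B.planeR = φ A.planeR ∧ B.planeS = φ A.planeS := by
  obtain ⟨h, hx, hy⟩ := h
  simp only [planeS, planeR, tateB, tateC, tangentA₁, tangentA₂, tangentNum, tangentDen, h, hx, hy,
    WeierstrassCurve.map_a₁, WeierstrassCurve.map_a₂, WeierstrassCurve.map_a₃,
    WeierstrassCurve.map_a₄, map_sub, map_div₀, map_mul, map_add, map_pow, map_neg, map_one,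
    map_ofNat, and_self]

section ToModel

variable [Algebra ℚ K] [Algebra ℚ L]

lemma model_nonsingular (A : EllipticCurveWithPoint 15 K) :
    (modelX₁Fifteen.baseChange K).toAffine.Nonsingular (planeToX A.planeR A.planeS)
      (planeToY A.planeS) := by
  obtain ⟨hr, hr1, hs, -, -, -, h0⟩ := A.plane_spec
  rw [modelX₁Fifteen_nonsingular_iff]
  exact planeTo_equation hs (levelFifteen_denominator_ne_zero hr hr1 h0) h0

/-- The point of `y² + xy + y = x³ + x²` classifying an elliptic curve with a point of
order `15`. -/
def toModel (A : EllipticCurveWithPoint 15 K) : (modelX₁Fifteen.baseChange K).toAffine.Point :=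
  .some _ _ A.model_nonsingular

lemma toModel_eq_iff (A B : EllipticCurveWithPoint 15 K) :
    A.toModel = B.toModel ↔ A.Isomorphic B := by
  rw [isomorphic_iff_plane, toModel, toModel, Point.some.injEq]
  constructor
  · rintro ⟨hx, hy⟩
    obtain ⟨hr, hr1, hs, hs1, -, -, h0⟩ := A.plane_spec
    obtain ⟨hr', hr1', hs', hs1', -, -, h0'⟩ := B.plane_spec
    constructor
    · rw [planeTo_left_inv hs hs1 (levelFifteen_denominator_ne_zero hr hr1 h0), hx, hy,
        ← planeTo_left_inv hs' hs1' (levelFifteen_denominator_ne_zero hr' hr1' h0')]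
    · rw [← inv_inj, ← planeToY_add_one hs, ← planeToY_add_one hs', hy]
  · rintro ⟨h₁, h₂⟩
    rw [h₁, h₂]
    exact ⟨rfl, rfl⟩

lemma exists_toModel_eq {x y : K} (h : (modelX₁Fifteen.baseChange K).toAffine.Nonsingular x y)
    (hx : cuspPolynomial x ≠ 0) : ∃ A : EllipticCurveWithPoint 15 K, A.toModel = .some x y h := by
  let := Classical.decEq K
  obtain ⟨r, s, hr, hr1, hs, hs1, h0, hΔ, rfl, rfl⟩ :=
    exists_plane_of_equation ((modelX₁Fifteen_nonsingular_iff x y).mp h) hx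
  have hn := tateCurve_nonsingular_zero (b := r * s * (r - 1)) (c := s * (r - 1))
    (mul_ne_zero (mul_ne_zero hr hs) hr1)
  let A : EllipticCurveWithPoint 15 K :=
    ⟨tateCurve (r * s * (r - 1)) (s * (r - 1)), ⟨isUnit_iff_ne_zero.mpr hΔ⟩, 0, 0, hn,
      tateCurve_addOrderOf hr hr1 hs hn h0⟩
  have hb : A.curve.tateB A.x A.y = r * s * (r - 1) := by
    simp only [A, tateB, tangentA₂, tangentNum, tangentDen, tateCurve]
    field_simp; ring
  have hc : A.curve.tateC A.x A.y = s * (r - 1) := by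
    simp only [A, tateC, tangentA₁, tangentA₂, tangentNum, tangentDen, tateCurve]
    field_simp; ring
  have hR : A.planeR = r := by rw [planeR, hb, hc]; field_simp
  have hS : A.planeS = s := by rw [planeS, hR, hc]; field_simp
  refine ⟨A, ?_⟩
  simp only [toModel, hR, hS]

end ToModel

end EllipticCurveWithPoint

lemma finite_setOf_cuspPolynomial_eq_zero (K : Type*) [Field K] :
    {x : K | cuspPolynomial x = 0}.Finite := by
  open Polynomial in
  let p : K[X] := X * (X + 1) * (X ^ 2 + X + 1) * (X ^ 4 + 3 * X ^ 3 + 4 * X ^ 2 + 2 * X + 1) *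
    (X ^ 4 - 7 * X ^ 3 - 6 * X ^ 2 + 2 * X + 1)
  have hp : p.Monic := by
    refine ((((Polynomial.monic_X).mul ?_).mul ?_).mul ?_).mul ?_ <;> monicity!
  refine (p.rootSet_finite K).subset fun x hx => ?_
  rw [Polynomial.mem_rootSet]
  refine ⟨hp.ne_zero, ?_⟩
  simpa [p, cuspPolynomial] using hx

/-- A set of points of an elliptic curve meeting finitely many vertical lines is finite. -/
lemma WeierstrassCurve.Affine.Point.finite_of_finite_x {K : Type*} [Field K]
    {W : WeierstrassCurve.Affine K} {S : Set K} (hS : S.Finite) {T : Set W.Point}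
    (hT : ∀ x y h, Point.some x y h ∈ T → x ∈ S) : T.Finite := by
  have : T ⊆ {0} ∪ ⋃ x ∈ S, {P | ∃ y h, P = Point.some x y h} := by
    rintro (_ | ⟨x, y, h⟩) hP
    · exact Or.inl rfl
    · exact Or.inr (Set.mem_biUnion (hT x y h hP) ⟨y, h, rfl⟩)
  refine ((Set.finite_singleton _).union (hS.biUnion fun x _ => ?_)).subset this
  by_cases hne : ∃ y, W.Nonsingular x y
  · obtain ⟨y, h⟩ := hne
    refine (Set.toFinite {Point.some x y h, -Point.some x y h}).subset ?_
    rintro _ ⟨y', h', rfl⟩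
    exact (Point.X_eq_iff (h₁ := h') (h₂ := h)).mp rfl
  · refine Set.Finite.subset Set.finite_empty ?_
    rintro _ ⟨y, h, rfl⟩
    exact hne ⟨y, h⟩

/-- The elliptic curve `y² + xy + y = x³ + x²` is `X₁(15)`. -/
theorem isModularCurveX₁_modelX₁Fifteen : IsModularCurveX₁ 15 modelX₁Fifteen := by
  refine ⟨inferInstance, fun K _ _ A => A.toModel, fun K _ _ A B => A.toModel_eq_iff B,
    fun K _ _ => ?_, fun K L _ _ _ _ φ A B h => ?_⟩
  · refine Point.finite_of_finite_x (finite_setOf_cuspPolynomial_eq_zero K) fun x y h hP => ?_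
    by_contra hx
    exact hP (EllipticCurveWithPoint.exists_toModel_eq h hx)
  · obtain ⟨hr, hs⟩ := h.plane_eq
    classical
    refine (Point.map_some φ A.model_nonsingular).trans ?_
    simp only [EllipticCurveWithPoint.toModel, Point.some.injEq, hr, hs]
    simp [planeToX, planeToY, map_ofNat φ 2]

/-! ### Heights and descent by doubling -/

open Height

namespace WeierstrassCurve.Affine.Point

section ParallelogramLaw

variable {K : Type*} [Field K] [DecidableEq K] (W : WeierstrassCurve K) [W.IsElliptic]

/-- The pair `(P, P)` is mapped to `(P + P, 0)` by the addition-and-subtraction map. -/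
lemma addSubMap_sym2x_self (P : W.toAffine.Point) : ∃ t : K, t ≠ 0 ∧
    (fun i => (addSubMap W i).eval (P.sym2x P)) = t • (P + P).sym2x 0 := by
  rcases P with _ | ⟨x, y, h⟩
  · refine ⟨1, one_ne_zero, ?_⟩
    rw [← zero_def, zero_add, sym2x_zero_zero]
    ext i
    fin_cases i <;> simp [addSubMap]
  · have e := (equation_iff' ..).mp h.1
    by_cases hd : 2 * y + W.a₁ * x + W.a₃ = 0
    · have hne := addSubMap_ne_zero W (sym2x_ne_zero (some x y h) (some x y h))
      rw [(add_self_eq_zero_iff h).mpr hd, sym2x_zero_zero]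
      rw [sym2x_some_some] at hne ⊢
      have h1 : (addSubMap W 1).eval ![x * x, x + x, 1] = 0 := by
        simp [addSubMap, b₂, b₄, b₆]
        linear_combination (2 * y + W.a₁ * x + W.a₃) * hd - 4 * e
      have h2 : (addSubMap W 2).eval ![x * x, x + x, 1] = 0 := by
        simp [addSubMap]; ring
      refine ⟨(addSubMap W 0).eval ![x * x, x + x, 1], fun h0 => hne ?_, ?_⟩
      · ext i; fin_cases i
        exacts [h0, h1, h2]
      · ext i; fin_cases i
        · simp
        · simpa using h1
        · simpa using h2
    · obtain ⟨ℓ, hℓ⟩ : ∃ ℓ : K, ℓ * (2 * y + W.a₁ * x + W.a₃) =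
          3 * x ^ 2 + 2 * W.a₂ * x + W.a₄ - W.a₁ * y := ⟨_, div_mul_cancel₀ _ hd⟩
      obtain ⟨h₃, e₃⟩ := exists_add_self_eq_some_of_tangent h hd hℓ rfl rfl
      rw [e₃, sym2x_some_some, sym2x_some_zero]
      refine ⟨(2 * y + W.a₁ * x + W.a₃) ^ 2, pow_ne_zero 2 hd, ?_⟩
      ext i; fin_cases i
      · simp [addSubMap, b₄, b₆, b₈]
        linear_combination (W.a₁ ^ 2 + 4 * W.a₂ + 8 * x) * e -
          (ℓ * (2 * y + W.a₁ * x + W.a₃) + 3 * x ^ 2 + 2 * W.a₂ * x + W.a₄ - W.a₁ * y +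
            W.a₁ * (2 * y + W.a₁ * x + W.a₃)) * hℓ
      · simp [addSubMap, b₂, b₄, b₆]
        linear_combination - 4 * e
      · simp [addSubMap]; ring

/-- The product of the `x`-coordinates of `P + Q` and `P - Q`, with denominators cleared. -/
lemma addX_mul_addX_neg {R : Type*} [CommRing R] {a₁ a₂ a₃ a₄ a₆ x₁ y₁ x₂ y₂ A B : R}
    (e₁ : y₁ ^ 2 + a₁ * x₁ * y₁ + a₃ * y₁ - (x₁ ^ 3 + a₂ * x₁ ^ 2 + a₄ * x₁ + a₆) = 0)
    (e₂ : y₂ ^ 2 + a₁ * x₂ * y₂ + a₃ * y₂ - (x₂ ^ 3 + a₂ * x₂ ^ 2 + a₄ * x₂ + a₆) = 0)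
    (hA : A = (y₁ - y₂) ^ 2 + a₁ * (y₁ - y₂) * (x₁ - x₂) - (a₂ + x₁ + x₂) * (x₁ - x₂) ^ 2)
    (hB : B = (y₁ - (-y₂ - a₁ * x₂ - a₃)) ^ 2 + a₁ * (y₁ - (-y₂ - a₁ * x₂ - a₃)) * (x₁ - x₂) -
      (a₂ + x₁ + x₂) * (x₁ - x₂) ^ 2) :
    A * B = (x₁ - x₂) ^ 2 * ((x₁ * x₂) ^ 2 - (2 * a₄ + a₁ * a₃) * (x₁ * x₂) -
      (a₃ ^ 2 + 4 * a₆) * (x₁ + x₂) -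
      (a₁ ^ 2 * a₆ + 4 * a₂ * a₆ - a₁ * a₃ * a₄ + a₂ * a₃ ^ 2 - a₄ ^ 2)) := by
  obtain ⟨E₁, hE₁⟩ : ∃ E, E = y₁ ^ 2 + a₁ * x₁ * y₁ + a₃ * y₁ -
    (x₁ ^ 3 + a₂ * x₁ ^ 2 + a₄ * x₁ + a₆) := ⟨_, rfl⟩
  obtain ⟨E₂, hE₂⟩ : ∃ E, E = y₂ ^ 2 + a₁ * x₂ * y₂ + a₃ * y₂ -
    (x₂ ^ 3 + a₂ * x₂ ^ 2 + a₄ * x₂ + a₆) := ⟨_, rfl⟩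
  rw [← hE₁] at e₁
  rw [← hE₂] at e₂
  have key : A * B - (x₁ - x₂) ^ 2 * ((x₁ * x₂) ^ 2 - (2 * a₄ + a₁ * a₃) * (x₁ * x₂) -
      (a₃ ^ 2 + 4 * a₆) * (x₁ + x₂) -
      (a₁ ^ 2 * a₆ + 4 * a₂ * a₆ - a₁ * a₃ * a₄ + a₂ * a₃ ^ 2 - a₄ ^ 2)) =
      (A + B - E₁ - E₂ - 2 * E₂ - (4 * (x₂ ^ 3 + a₂ * x₂ ^ 2 + a₄ * x₂ + a₆) +
        (a₁ * x₂ + a₃) ^ 2)) * E₁ +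
      (A + B - E₁ - E₂ - 2 * E₁ - (4 * (x₁ ^ 3 + a₂ * x₁ ^ 2 + a₄ * x₁ + a₆) +
        (a₁ * x₁ + a₃) ^ 2)) * E₂ := by
    subst hA hB hE₁ hE₂
    ring
  rw [e₁, e₂, mul_zero, mul_zero, add_zero, sub_eq_zero] at key
  exact key

lemma addSubMap_sym2x (P Q : W.toAffine.Point) : ∃ t : K, t ≠ 0 ∧
    (fun i => (addSubMap W i).eval (P.sym2x Q)) = t • (P + Q).sym2x (P - Q) := by
  by_cases hPQ : P = Q
  · subst hPQ
    rw [sub_self]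
    exact addSubMap_sym2x_self W P
  by_cases hPQ' : P = -Q
  · subst hPQ'
    obtain ⟨t, ht, e⟩ := addSubMap_sym2x_self W Q
    refine ⟨t, ht, ?_⟩
    rw [sym2x_neg_left, e, neg_add_cancel, sym2x_comm, ← sym2x_neg_right]
    congr 2
    abel
  rcases P with _ | ⟨x₁, y₁, h₁⟩
  · rw [← zero_def, zero_add, zero_sub, sym2x_neg_right]
    rcases Q with _ | ⟨x₂, y₂, h₂⟩
    · exact absurd rfl hPQ
    · refine ⟨1, one_ne_zero, ?_⟩
      rw [sym2x_zero_some, sym2x_some_some]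
      ext i
      fin_cases i <;> simp [addSubMap] <;> ring
  rcases Q with _ | ⟨x₂, y₂, h₂⟩
  · rw [← zero_def, add_zero, sub_zero]
    refine ⟨1, one_ne_zero, ?_⟩
    rw [sym2x_some_zero, sym2x_some_some]
    ext i
    fin_cases i <;> simp [addSubMap] <;> ring
  have hx : x₁ ≠ x₂ := fun hx => by
    rcases (X_eq_iff (h₁ := h₁) (h₂ := h₂)).mp hx with e | e
    exacts [hPQ e, hPQ' e]
  have e₁ := (equation_iff' ..).mp h₁.1
  have e₂ := (equation_iff' ..).mp h₂.1
  have hx' := sub_ne_zero.mpr hx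
  obtain ⟨h₃, e₃⟩ := exists_add_eq_some_of_chord h₁ h₂ hx (div_mul_cancel₀ _ hx') rfl rfl
  obtain ⟨h₄, e₄⟩ := exists_add_eq_some_of_chord h₁ ((nonsingular_neg ..).mpr h₂) hx
    (div_mul_cancel₀ _ hx') rfl rfl
  rw [sub_eq_add_neg, neg_some, e₃, e₄, sym2x_some_some, sym2x_some_some]
  refine ⟨(x₁ - x₂) ^ 2, pow_ne_zero 2 hx', ?_⟩
  ext i; fin_cases i
  · have key := addX_mul_addX_neg e₁ e₂ rfl rfl
    simp [addSubMap, b₄, b₆, b₈, negY]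
    field_simp
    linear_combination -key
  · simp [addSubMap, b₂, b₄, b₆, negY]
    field_simp
    linear_combination -2 * e₁ - 2 * e₂
  · simp [addSubMap]; ring

variable [AdmissibleAbsValues K]

/-- The approximate parallelogram law for the naive height `P ↦ h(x(P))`. -/
theorem exists_abs_logHeight_xRep_le : ∃ C : ℝ, ∀ P Q : W.toAffine.Point,
    |logHeight (P + Q).xRep + logHeight (P - Q).xRep -
      2 * (logHeight P.xRep + logHeight Q.xRep)| ≤ C := by
  obtain ⟨C₁, h₁⟩ := abs_logHeight_addSubMap_sub_two_mul_logHeight_le W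
  obtain ⟨C₂, h₂⟩ := abs_logHeight_sym2_sub_le K
  have hs : ∀ P Q : W.toAffine.Point,
      |logHeight (P.sym2x Q) - (logHeight P.xRep + logHeight Q.xRep)| ≤ C₂ := fun P Q => by
    have e : ∀ P : W.toAffine.Point, ![P.xRep 0, P.xRep 1] = P.xRep := fun P => by
      ext i; fin_cases i <;> rfl
    have := h₂ (a := P.xRep 0) (b := P.xRep 1) (c := Q.xRep 0) (d := Q.xRep 1)
      (by rw [e]; exact xRep_ne_zero P) (by rw [e]; exact xRep_ne_zero Q)
    rwa [e, e] at this
  refine ⟨C₁ + 3 * C₂, fun P Q => ?_⟩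
  obtain ⟨t, ht, e⟩ := addSubMap_sym2x W P Q
  have h3 := h₁ (P.sym2x Q)
  rw [e, logHeight_smul_eq_logHeight _ ht] at h3
  have h4 := hs (P + Q) (P - Q)
  have h5 := hs P Q
  rw [abs_le] at *
  constructor <;> linarith [h3.1, h3.2, h4.1, h4.2, h5.1, h5.2]

end ParallelogramLaw

section Finiteness

variable {K : Type*} [Field K] [NumberField K] [DecidableEq K] (W : WeierstrassCurve K)

instance northcott_logHeight_xRep :
    Northcott (fun P : W.toAffine.Point => logHeight P.xRep) where
  finite_le B := by
    refine finite_of_finite_x (Northcott.finite_le (h := logHeight₁ (K := K)) B)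
      fun x y h hP => ?_
    rw [Set.mem_ofPred_eq, xRep_some, ← logHeight₁_eq_logHeight] at hP
    exact hP

end Finiteness

end WeierstrassCurve.Affine.Point

/-- A finitely generated abelian group that is generated modulo `2` by finitely many torsion
elements is finite. -/
lemma AddCommGroup.finite_of_fg_of_two_nsmul {G : Type*} [AddCommGroup G] [AddGroup.FG G]
    {S : Set G} (hS : S.Finite) (hS' : ∀ T ∈ S, IsOfFinAddOrder T)
    (h : ∀ P : G, ∃ R : G, ∃ T ∈ S, P + T = 2 • R) : Finite G := by
  classical
  obtain ⟨m, hm, hmS⟩ : ∃ m : ℤ, m ≠ 0 ∧ ∀ T ∈ S, m • T = 0 := by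
    refine ⟨((∏ T ∈ hS.toFinset, addOrderOf T : ℕ) : ℤ), ?_, fun T hT => ?_⟩
    · rw [Nat.cast_ne_zero, Finset.prod_ne_zero_iff]
      intro T hT
      exact (hS' T (hS.mem_toFinset.mp hT)).addOrderOf_pos.ne'
    · rw [natCast_zsmul, ← addOrderOf_dvd_iff_nsmul_eq_zero]
      exact Finset.dvd_prod_of_mem _ (hS.mem_toFinset.mpr hT)
  have : Module.Finite ℤ G := Module.Finite.iff_addGroup_fg.mpr inferInstance
  let N : Submodule ℤ G := (⊤ : Submodule ℤ G).map (LinearMap.lsmul ℤ G m)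
  have hN : N.FG := (Module.Finite.fg_top).map _
  obtain ⟨r, hr, hrN⟩ := Submodule.exists_sub_one_mem_and_smul_eq_zero_of_fg_of_le_smul
    (Ideal.span {(2 : ℤ)}) N hN (by
      rintro _ ⟨P, -, rfl⟩
      obtain ⟨R, T, hT, e⟩ := h P
      have : LinearMap.lsmul ℤ G m P = (2 : ℤ) • LinearMap.lsmul ℤ G m R := by
        rw [LinearMap.lsmul_apply, LinearMap.lsmul_apply, smul_comm, ofNat_zsmul, ← e, smul_add,
          hmS T hT, add_zero]
      rw [this]
      exact Submodule.smul_mem_smul (Ideal.mem_span_singleton_self _) ⟨R, trivial, rfl⟩)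
  rw [Ideal.mem_span_singleton] at hr
  have hr0 : r ≠ 0 := by rintro rfl; omega
  refine AddCommGroup.finite_of_fg_isAddTorsion G fun P => ?_
  rw [isOfFinAddOrder_iff_zsmul_eq_zero]
  exact ⟨r * m, mul_ne_zero hr0 hm, by rw [mul_smul]; exact hrN _ ⟨P, trivial, rfl⟩⟩

/-- Descent: if the group of rational points is generated modulo `2` by finitely many torsion
points, then it is finite. -/
theorem WeierstrassCurve.Affine.Point.finite_of_two_nsmul {K : Type*} [Field K] [NumberField K]
    [DecidableEq K] (W : WeierstrassCurve K) [W.IsElliptic] {S : Set W.toAffine.Point}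
    (hS : S.Finite) (hS' : ∀ T ∈ S, IsOfFinAddOrder T)
    (h : ∀ P : W.toAffine.Point, ∃ R : W.toAffine.Point, ∃ T ∈ S, P + T = 2 • R) :
    Finite W.toAffine.Point := by
  obtain ⟨C, hC⟩ := exists_abs_logHeight_xRep_le W
  have hfi : (nsmulAddMonoidHom (α := W.toAffine.Point) 2).range.FiniteIndex := by
    have := hS.to_subtype
    have : Finite (W.toAffine.Point ⧸ (nsmulAddMonoidHom (α := W.toAffine.Point) 2).range) := by
      refine Finite.of_surjective (fun T : S => QuotientAddGroup.mk (-T.1)) fun q => ?_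
      obtain ⟨P, rfl⟩ := QuotientAddGroup.mk_surjective q
      obtain ⟨R, T, hT, e⟩ := h P
      refine ⟨⟨T, hT⟩, ?_⟩
      rw [QuotientAddGroup.eq, neg_neg, add_comm, e]
      exact ⟨R, rfl⟩
    exact AddSubgroup.finiteIndex_of_finite_quotient
  have : AddGroup.FG W.toAffine.Point :=
    AddCommGroup.fg_of_descent' (h := fun P => logHeight P.xRep) hfi
      (fun P => logHeight_nonneg _) hC
  exact AddCommGroup.finite_of_fg_of_two_nsmul hS hS' h

/-! ### Two-isogeny descent on the twists -/

/-- The curve `y² = x(x² - 7dx + 16d²)`, isomorphic to the quadratic twist by `d` of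
`y² + xy + y = x³ + x²`, with its rational `2`-torsion point moved to `(0, 0)`. -/
def twistModel (d : ℚ) : WeierstrassCurve ℚ := ⟨0, -7 * d, 0, 16 * d ^ 2, 0⟩

lemma twistModel_Δ_ne_zero {d : ℚ} (hd : d ≠ 0) : (twistModel d).Δ ≠ 0 := by
  have : (twistModel d).Δ = -61440 * d ^ 6 := by
    simp only [twistModel, WeierstrassCurve.Δ, WeierstrassCurve.b₂, WeierstrassCurve.b₄,
      WeierstrassCurve.b₆, WeierstrassCurve.b₈]
    ring
  rw [this]
  exact mul_ne_zero (by norm_num) (pow_ne_zero 6 hd)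

lemma twistModel_nonsingular_iff {d : ℚ} (hd : d ≠ 0) (x y : ℚ) :
    (twistModel d).toAffine.Nonsingular x y ↔ y ^ 2 = x * (x ^ 2 - 7 * d * x + 16 * d ^ 2) := by
  rw [← equation_iff_nonsingular_of_Δ_ne_zero (twistModel_Δ_ne_zero hd), equation_iff]
  simp only [twistModel]
  constructor <;> intro h <;> linear_combination h

namespace twistModel

variable {d : ℚ}

/-- The function `X = 2w² - 7d + 2v` on the `2`-isogenous curve `Y² = X(X + 15d)(X - d)`,
pulled back along the dual isogeny: here `(w², wv)` is a point of the twist. -/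
lemma isogenous_equation {w v : ℚ} (hv : v ^ 2 = w ^ 4 - 7 * d * w ^ 2 + 16 * d ^ 2) :
    (2 * w ^ 2 - 7 * d + 2 * v + 15 * d) * (2 * w ^ 2 - 7 * d + 2 * v - d) =
      4 * w ^ 2 * (2 * w ^ 2 - 7 * d + 2 * v) := by
  linear_combination 4 * hv

/-- If `X` is a square at `(w², wv)`, this point is a double: it has a preimage under the dual
isogeny which in turn has a preimage under the isogeny. -/
lemma exists_eq_two_nsmul (hd : d ≠ 0) {w v s : ℚ}
    (hv : v ^ 2 = w ^ 4 - 7 * d * w ^ 2 + 16 * d ^ 2) (hs : 2 * w ^ 2 - 7 * d + 2 * v = s ^ 2)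
    {y : ℚ} (h : (twistModel d).toAffine.Nonsingular (w ^ 2) y) :
    ∃ R : (twistModel d).toAffine.Point, Point.some _ _ h = 2 • R := by
  have hX := isogenous_equation hv
  rw [hs] at hX
  obtain ⟨x, hx⟩ : ∃ x, x = (s ^ 2 + 7 * d) / 2 + w * s := ⟨_, rfl⟩
  have hs0 : s ≠ 0 := by
    rintro rfl
    have : d ^ 2 = 0 := by linear_combination (-1 / 15) * hX
    exact hd (pow_eq_zero_iff two_ne_zero |>.mp this)
  have hx2 : x ^ 2 - 7 * d * x + 16 * d ^ 2 = s ^ 2 * x := by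
    rw [hx]; linear_combination (-1 / 4) * hX
  have hx0 : x ≠ 0 := by
    rintro rfl
    have : d ^ 2 = 0 := by linear_combination (1 / 16) * hx2
    exact hd (pow_eq_zero_iff two_ne_zero |>.mp this)
  have hR : (twistModel d).toAffine.Nonsingular x (s * x) := by
    rw [twistModel_nonsingular_iff hd]
    linear_combination -x * hx2
  obtain ⟨h₃, e₃⟩ := Point.exists_add_self_eq_some_of_tangent (ℓ := s + w) (x₃ := w ^ 2) hR
    (by simpa [twistModel] using ⟨hs0, hx0⟩)
    (by
      simp only [twistModel]
      linear_combination -hx2 - 2 * x * hx)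
    (by simp only [twistModel]; rw [hx]; ring) rfl
  rcases (Point.X_eq_iff (h₁ := h) (h₂ := h₃)).mp rfl with e | e
  · exact ⟨Point.some _ _ hR, by rw [e, ← e₃, two_nsmul]⟩
  · exact ⟨-Point.some _ _ hR, by rw [e, ← e₃, two_nsmul, neg_add]⟩

/-- The `2`-torsion point `(0, 0)`. -/
lemma nonsingular_zero (hd : d ≠ 0) : (twistModel d).toAffine.Nonsingular 0 0 := by
  rw [twistModel_nonsingular_iff hd]; ring

lemma two_torsion (hd : d ≠ 0) :
    Point.some 0 0 (nonsingular_zero hd) + Point.some 0 0 (nonsingular_zero hd) = 0 := by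
  rw [Point.add_self_eq_zero_iff]; simp [twistModel]

lemma exists_add_two_torsion_eq (hd : d ≠ 0) {w v : ℚ} (hw : w ≠ 0)
    (hv : v ^ 2 = w ^ 4 - 7 * d * w ^ 2 + 16 * d ^ 2)
    (h : (twistModel d).toAffine.Nonsingular (w ^ 2) (w * v)) :
    ∃ h', Point.some _ _ h + Point.some _ _ (nonsingular_zero hd) =
      Point.some (W' := (twistModel d).toAffine) ((4 * d / w) ^ 2)
        ((4 * d / w) * (-4 * d * v / w ^ 2)) h' := by
  refine Point.exists_add_eq_some_of_chord (ℓ := v / w) h (nonsingular_zero hd)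
    (pow_ne_zero 2 hw) (by field_simp; ring) ?_ ?_
  · simp only [twistModel]
    field_simp
    linear_combination -hv
  · simp only [twistModel]
    field_simp
    ring

/-- If `X` is a square or `-15` times a square at a point `(w², wv)`, this point is a double:
the two values of `X` over the same `w²` have product `-15d²`. -/
lemma exists_eq_two_nsmul' (hd : d ≠ 0) {w v s : ℚ}
    (hv : v ^ 2 = w ^ 4 - 7 * d * w ^ 2 + 16 * d ^ 2)
    (hs : 2 * w ^ 2 - 7 * d + 2 * v = s ^ 2 ∨ 2 * w ^ 2 - 7 * d + 2 * v = -15 * s ^ 2)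
    {y : ℚ} (h : (twistModel d).toAffine.Nonsingular (w ^ 2) y) :
    ∃ R : (twistModel d).toAffine.Point, Point.some _ _ h = 2 • R := by
  rcases hs with hs | hs
  · exact exists_eq_two_nsmul hd hv hs h
  · have hprod : (2 * w ^ 2 - 7 * d + 2 * v) * (2 * w ^ 2 - 7 * d + 2 * -v) = -15 * d ^ 2 := by
      linear_combination -4 * hv
    have hs0 : s ≠ 0 := by
      rintro rfl
      rw [hs] at hprod
      have : d ^ 2 = 0 := by linear_combination (1 / 15) * hprod
      exact hd (pow_eq_zero_iff two_ne_zero |>.mp this)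
    refine exists_eq_two_nsmul hd (v := -v) (s := d / s) (by rw [neg_sq, hv]) ?_ h
    rw [hs] at hprod
    rw [div_pow, eq_div_iff (pow_ne_zero 2 hs0)]
    linear_combination (-1 / 15) * hprod

lemma X_ne_zero (hd : d ≠ 0) {w v : ℚ} (hv : v ^ 2 = w ^ 4 - 7 * d * w ^ 2 + 16 * d ^ 2) :
    2 * w ^ 2 - 7 * d + 2 * v ≠ 0 := by
  intro h
  have hprod : (2 * w ^ 2 - 7 * d + 2 * v) * (2 * w ^ 2 - 7 * d + 2 * -v) = -15 * d ^ 2 := by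
    linear_combination -4 * hv
  rw [h] at hprod
  have : d ^ 2 = 0 := by linear_combination (1 / 15) * hprod
  exact hd (pow_eq_zero_iff two_ne_zero |>.mp this)

/-- Every point is either `0`, or `(0, 0)`, or of the form `(w², wv)`, provided that the first
descent shows that every nonzero `x`-coordinate is a square. -/
lemma eq_zero_or_exists_sq (hd : d ≠ 0)
    (hx : ∀ x y : ℚ, x ≠ 0 → y ^ 2 = x * (x ^ 2 - 7 * d * x + 16 * d ^ 2) → ∃ w, x = w ^ 2)
    (P : (twistModel d).toAffine.Point) :
    P = 0 ∨ P = Point.some 0 0 (nonsingular_zero hd) ∨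
      ∃ w v, w ≠ 0 ∧ v ^ 2 = w ^ 4 - 7 * d * w ^ 2 + 16 * d ^ 2 ∧
        ∃ h, P = Point.some (w ^ 2) (w * v) h := by
  rcases P with _ | ⟨x, y, h⟩
  · exact Or.inl rfl
  · right
    have e := (twistModel_nonsingular_iff hd x y).mp h
    by_cases hx0 : x = 0
    · left
      subst hx0
      have hy : y = 0 := by simpa using e
      subst hy
      rfl
    · right
      obtain ⟨w, rfl⟩ := hx x y hx0 e
      have hw : w ≠ 0 := by rintro rfl; simp at hx0
      obtain ⟨v, rfl⟩ : ∃ v, y = w * v := ⟨y / w, by field_simp⟩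
      refine ⟨w, v, hw, mul_left_cancel₀ (pow_ne_zero 2 hw) ?_, h, rfl⟩
      linear_combination e

/-- Descent on the twist: if the image of the first descent map is trivial and that of the second
one consists of the classes of the `2`-torsion points, then there are only finitely many rational
points. -/
lemma finite_of_classes (hd : d ≠ 0)
    (hx : ∀ x y : ℚ, x ≠ 0 → y ^ 2 = x * (x ^ 2 - 7 * d * x + 16 * d ^ 2) → ∃ w, x = w ^ 2)
    (hX : ∀ X w : ℚ, X ≠ 0 → w ≠ 0 → (X + 15 * d) * (X - d) = 4 * w ^ 2 * X →
      ∃ s, X = s ^ 2 ∨ X = -15 * s ^ 2 ∨ X = d * s ^ 2 ∨ X = -15 * d * s ^ 2) :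
    Finite (twistModel d).toAffine.Point := by
  have : (twistModel d).IsElliptic := ⟨isUnit_iff_ne_zero.mpr (twistModel_Δ_ne_zero hd)⟩
  have hT := two_torsion hd
  refine Point.finite_of_two_nsmul (twistModel d)
    (S := {0, Point.some 0 0 (nonsingular_zero hd)}) (Set.toFinite _) ?_ fun P => ?_
  · rintro T (rfl | rfl)
    · exact .zero
    · exact isOfFinAddOrder_iff_nsmul_eq_zero.mpr ⟨2, by norm_num, by rw [two_nsmul, hT]⟩
  rcases eq_zero_or_exists_sq hd hx P with rfl | rfl | ⟨w, v, hw, hv, h, rfl⟩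
  · exact ⟨0, 0, Or.inl rfl, by simp⟩
  · exact ⟨0, _, Or.inr rfl, by rw [hT]; simp⟩
  have hX0 := X_ne_zero hd hv
  have heq := isogenous_equation hv
  obtain ⟨s, hs⟩ := hX _ w hX0 hw heq
  by_cases hs' : 2 * w ^ 2 - 7 * d + 2 * v = s ^ 2 ∨ 2 * w ^ 2 - 7 * d + 2 * v = -15 * s ^ 2
  · obtain ⟨R, hR⟩ := exists_eq_two_nsmul' hd hv hs' h
    exact ⟨R, 0, Or.inl rfl, by rw [add_zero, hR]⟩
  · -- Adding `(0, 0)` multiplies the class of `X` by `d`, up to `-15`.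
    obtain ⟨h', e'⟩ := exists_add_two_torsion_eq hd hw hv h
    have hv' : (-v) ^ 2 = w ^ 4 - 7 * d * w ^ 2 + 16 * d ^ 2 := by rw [neg_sq, hv]
    have hX0' := X_ne_zero hd hv'
    have heq' := isogenous_equation hv'
    have hprod : (2 * w ^ 2 - 7 * d + 2 * v) * (2 * w ^ 2 - 7 * d + 2 * -v) = -15 * d ^ 2 := by
      linear_combination -4 * hv
    have hne : w ^ 2 - 4 * d - v ≠ 0 := by
      intro h0
      have e : 2 * w ^ 2 - 7 * d + 2 * -v = d := by linear_combination 2 * h0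
      rw [e, sub_self, mul_zero] at heq'
      exact mul_ne_zero (mul_ne_zero four_ne_zero (pow_ne_zero 2 hw)) hd heq'.symm
    have hs0 : s ≠ 0 := by
      rintro rfl
      apply hX0
      rcases hs with h | h | h | h <;> simp [h]
    have hXT : (2 * (4 * d / w) ^ 2 - 7 * d + 2 * (-4 * d * v / w ^ 2)) *
        (w ^ 2 - 4 * d - v) ^ 2 = d * w ^ 2 * (2 * w ^ 2 - 7 * d + 2 * -v) := by
      field_simp
      linear_combination (-8 * v + 9 * w ^ 2 - 32 * d) * hv
    obtain ⟨R, hR⟩ := exists_eq_two_nsmul' hd (w := 4 * d / w) (v := -4 * d * v / w ^ 2)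
      (s := d * w / (s * (w ^ 2 - 4 * d - v))) (by
        field_simp
        linear_combination 16 * hv) (by
        have hne2 : (w ^ 2 - 4 * d - v) ^ 2 ≠ 0 := pow_ne_zero 2 hne
        rw [← mul_left_inj' hne2, ← mul_left_inj' hne2 (b := -15 * _), hXT]
        have es : d * w / (s * (w ^ 2 - 4 * d - v)) * (w ^ 2 - 4 * d - v) = d * w / s := by
          rw [div_mul_eq_mul_div, mul_div_mul_right _ _ hne]
        rw [mul_assoc (-15 : ℚ), ← mul_pow, es, div_pow]
        rcases hs with hs | hs | hs | hs
        · exact absurd (Or.inl hs) hs'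
        · exact absurd (Or.inr hs) hs'
        · right
          rw [hs] at hprod
          rw [← mul_div_assoc, eq_div_iff (pow_ne_zero 2 hs0)]
          linear_combination w ^ 2 * hprod
        · left
          rw [hs] at hprod
          rw [eq_div_iff (pow_ne_zero 2 hs0)]
          linear_combination (-1 / 15) * w ^ 2 * hprod) h'
    exact ⟨R, _, Or.inr rfl, by rw [e', hR]⟩

section Untwisted

lemma nonsingular_four : (twistModel 1).toAffine.Nonsingular 4 4 := by
  rw [twistModel_nonsingular_iff one_ne_zero]; norm_num

lemma two_nsmul_four : 2 • Point.some 4 4 nonsingular_four =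
    Point.some 0 0 (nonsingular_zero one_ne_zero) := by
  obtain ⟨h, e⟩ := Point.exists_add_self_eq_some_of_tangent (ℓ := 1) (x₃ := 0) (y₃ := 0)
    nonsingular_four (by norm_num [twistModel]) (by norm_num [twistModel])
    (by norm_num [twistModel]) (by norm_num [twistModel])
  rw [two_nsmul, e]

/-- Descent on the untwisted curve: here the image of the second descent map contains moreover
the class of the point `(4, 4)` of order `4`. -/
lemma finite_of_classes_one
    (hx : ∀ x y : ℚ, x ≠ 0 → y ^ 2 = x * (x ^ 2 - 7 * 1 * x + 16 * 1 ^ 2) → ∃ w, x = w ^ 2)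
    (hX : ∀ X w : ℚ, X ≠ 0 → w ≠ 0 → (X + 15 * 1) * (X - 1) = 4 * w ^ 2 * X →
      ∃ s, X = s ^ 2 ∨ X = -15 * s ^ 2 ∨ X = 5 * s ^ 2 ∨ X = -3 * s ^ 2) :
    Finite (twistModel 1).toAffine.Point := by
  have hd : (1 : ℚ) ≠ 0 := one_ne_zero
  have : (twistModel 1).IsElliptic := ⟨isUnit_iff_ne_zero.mpr (twistModel_Δ_ne_zero hd)⟩
  have hT := two_torsion hd
  have hQ := two_nsmul_four
  have hQ4 : 4 • Point.some 4 4 nonsingular_four = 0 := by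
    rw [show 4 = 2 * 2 from rfl, mul_nsmul, hQ, two_nsmul, hT]
  have hQfin : IsOfFinAddOrder (Point.some 4 4 nonsingular_four) :=
    isOfFinAddOrder_iff_nsmul_eq_zero.mpr ⟨4, by norm_num, hQ4⟩
  refine Point.finite_of_two_nsmul (twistModel 1) (S := {0, Point.some 4 4 nonsingular_four,
    -Point.some 4 4 nonsingular_four}) (Set.toFinite _) ?_ fun P => ?_
  · rintro T (rfl | rfl | rfl)
    · exact .zero
    · exact hQfin
    · exact hQfin.neg
  rcases eq_zero_or_exists_sq hd hx P with rfl | rfl | ⟨w, v, hw, hv, h, rfl⟩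
  · exact ⟨0, 0, Or.inl rfl, by simp⟩
  · exact ⟨_, 0, Or.inl rfl, by rw [add_zero, hQ]⟩
  by_cases hw4 : w ^ 2 = 4
  · rcases (Point.X_eq_iff (h₁ := h) (h₂ := nonsingular_four)).mp hw4 with e | e
    · exact ⟨0, _, Or.inr (Or.inr rfl), by rw [e, add_neg_cancel, nsmul_zero]⟩
    · exact ⟨0, _, Or.inr (Or.inl rfl), by rw [e, neg_add_cancel, nsmul_zero]⟩
  have hm : w ^ 2 - 4 ≠ 0 := sub_ne_zero.mpr hw4
  have hX0 := X_ne_zero hd hv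
  have heq := isogenous_equation hv
  obtain ⟨s, hs⟩ := hX _ w hX0 hw heq
  by_cases hs' : 2 * w ^ 2 - 7 * 1 + 2 * v = s ^ 2 ∨ 2 * w ^ 2 - 7 * 1 + 2 * v = -15 * s ^ 2
  · obtain ⟨R, hR⟩ := exists_eq_two_nsmul' hd hv hs' h
    exact ⟨R, 0, Or.inl rfl, by rw [add_zero, hR]⟩
  · have hX5 : 2 * w ^ 2 - 7 * 1 + 2 * v - 5 ≠ 0 := by
      intro h0
      have e : 2 * w ^ 2 - 7 * 1 + 2 * v = 5 := by linear_combination h0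
      rw [e] at heq
      exact hw4 (by linear_combination (-1 / 20) * heq)
    have hs0 : s ≠ 0 := by
      rintro rfl
      apply hX0
      rcases hs with h | h | h | h <;> rw [h] <;> ring
    -- The square roots of the `x`-coordinate of `(w², wv) + (4, 4)`, and the quotient of its
    -- `y`-coordinate by that root.
    obtain ⟨k, hk⟩ : ∃ k, k = (v - w) / (w ^ 2 - 4) := ⟨_, rfl⟩
    obtain ⟨ℓ, hℓ⟩ : ∃ ℓ, ℓ = (w * v - 4) / (w ^ 2 - 4) := ⟨_, rfl⟩
    have hk' : k * (w ^ 2 - 4) = v - w := by rw [hk, div_mul_cancel₀ _ hm]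
    have hℓ' : ℓ * (w ^ 2 - 4) = w * v - 4 := by rw [hℓ, div_mul_cancel₀ _ hm]
    obtain ⟨h', e'⟩ := Point.exists_add_eq_some_of_chord (ℓ := ℓ) (x₃ := (2 * k) ^ 2)
      (y₃ := (2 * k) * (2 * w - 2 * k * ℓ)) h nonsingular_four hw4 hℓ'
      (by
        simp only [twistModel]
        rw [hk, hℓ]
        field_simp
        linear_combination 4 * hv - w ^ 2 * hv) (by
        simp only [twistModel]
        rw [hk, hℓ]
        field_simp
        ring)
    have hv' : (2 * w - 2 * k * ℓ) ^ 2 = (2 * k) ^ 4 - 7 * 1 * (2 * k) ^ 2 + 16 * 1 ^ 2 := by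
      rw [hk, hℓ]
      field_simp
      linear_combination (4 * v ^ 2 * w ^ 2 - 16 * v ^ 2 - 8 * v * w ^ 3 + 32 * v * w - 4 * w ^ 6 +
        52 * w ^ 4 - 208 * w ^ 2 + 256) * hv
    have hXT : (2 * (2 * k) ^ 2 - 7 * 1 + 2 * (2 * w - 2 * k * ℓ)) *
        (2 * w ^ 2 - 7 * 1 + 2 * v - 5) ^ 2 =
        5 * (2 * (2 - w)) ^ 2 * (2 * w ^ 2 - 7 * 1 + 2 * v) := by
      rw [hk, hℓ]
      field_simp
      linear_combination (-16 * v ^ 2 * w + 32 * v ^ 2 - 32 * v * w ^ 3 + 80 * v * w ^ 2 +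
        128 * v * w - 320 * v - 16 * w ^ 5 + 68 * w ^ 4 + 48 * w ^ 3 - 416 * w ^ 2 + 128 * w +
        448) * hv
    have hne2 := pow_ne_zero 2 hX5
    rcases hs with hs | hs | hs | hs
    · exact absurd (Or.inl hs) hs'
    · exact absurd (Or.inr hs) hs'
    · obtain ⟨R, hR⟩ := exists_eq_two_nsmul' hd (w := 2 * k) (v := 2 * w - 2 * k * ℓ)
        (s := 5 * (2 * (2 - w)) * s / (2 * w ^ 2 - 7 * 1 + 2 * v - 5)) hv' (Or.inl (by
          rw [div_pow, eq_div_iff hne2, hXT, hs]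
          ring)) h'
      exact ⟨R, _, Or.inr (Or.inl rfl), by rw [e', hR]⟩
    · obtain ⟨R, hR⟩ := exists_eq_two_nsmul' hd (w := 2 * k) (v := 2 * w - 2 * k * ℓ)
        (s := 2 * (2 - w) * s / (2 * w ^ 2 - 7 * 1 + 2 * v - 5)) hv' (Or.inr (by
          rw [div_pow, ← mul_div_assoc, eq_div_iff hne2, hXT, hs]
          ring)) h'
      exact ⟨R, _, Or.inr (Or.inl rfl), by rw [e', hR]⟩

end Untwisted

end twistModel

/-! ### Quartics attached to the descent and their local obstructions -/

section Quartic

/-- A nonzero `x`-coordinate on `y² = x(x² + ax + b)` has the form `e(M/L)²` with `e` a squarefree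
divisor of `b`, and then the point gives an integral solution of a quartic equation. -/
lemma exists_quartic {a b : ℤ} {x y : ℚ} (hx : x ≠ 0) (h : y ^ 2 = x * (x ^ 2 + a * x + b)) :
    ∃ e M L N : ℤ, Squarefree e ∧ e ∣ b ∧ M ≠ 0 ∧ L ≠ 0 ∧ IsCoprime M L ∧ IsCoprime e L ∧
      x = e * (M / L : ℚ) ^ 2 ∧
      e * N ^ 2 = e ^ 2 * M ^ 4 + a * e * M ^ 2 * L ^ 2 + b * L ^ 4 := by
  obtain ⟨e, s, he, hs, rfl⟩ : ∃ (e : ℤ) (s : ℚ), Squarefree e ∧ s ≠ 0 ∧ x = e * s ^ 2 := by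
    obtain ⟨f, k, hfk, hf⟩ := Nat.sq_mul_squarefree (x.num * x.den).natAbs
    have hxn : x.num ≠ 0 := Rat.num_ne_zero.mpr hx
    have hden : (x.den : ℚ) ≠ 0 := Nat.cast_ne_zero.mpr x.den_ne_zero
    have hk : k ≠ 0 := by
      rintro rfl
      have : (x.num * x.den).natAbs = 0 := by rw [← hfk]; ring
      simp [hxn] at this
    refine ⟨x.num.sign * f, k / x.den, ?_, ?_, ?_⟩
    · rw [← Int.squarefree_natAbs, Int.natAbs_mul, Int.natAbs_sign_of_ne_zero hxn]
      simpa using hf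
    · exact div_ne_zero (Nat.cast_ne_zero.mpr hk) hden
    · have e₁ : ((k ^ 2 * f : ℕ) : ℤ) = |x.num| * x.den := by
        rw [hfk, Int.natCast_natAbs, abs_mul, Nat.abs_cast]
      have e₂ : x.num.sign * ((k : ℤ) ^ 2 * f) = x.num * x.den := by
        have := Int.sign_mul_abs x.num
        push_cast at e₁
        rw [e₁, ← mul_assoc, this]
      have e₃ : ((x.num.sign : ℤ) : ℚ) * ((k : ℚ) ^ 2 * f) = x.num * x.den := by
        exact_mod_cast e₂
      have e₄ : x * x.den = x.num := Rat.mul_den_eq_num x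
      push_cast
      field_simp
      linear_combination x.den * e₄ - e₃
  obtain ⟨M, hM⟩ : ∃ M, M = s.num := ⟨_, rfl⟩
  obtain ⟨L, hL⟩ : ∃ L : ℤ, L = s.den := ⟨_, rfl⟩
  have hL0 : L ≠ 0 := by rw [hL]; exact_mod_cast s.den_ne_zero
  have hM0 : M ≠ 0 := by rw [hM]; exact Rat.num_ne_zero.mpr hs
  have hLq : (L : ℚ) ≠ 0 := by exact_mod_cast hL0
  have hML : IsCoprime M L := by
    rw [hM, hL, Int.isCoprime_iff_nat_coprime]
    simpa using s.reduced
  have hsq : s = M / L := by rw [hM, hL]; exact_mod_cast (Rat.num_div_den s).symm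
  obtain ⟨K, hK⟩ : IsSquare (e * (e ^ 2 * M ^ 4 + a * e * M ^ 2 * L ^ 2 + b * L ^ 4)) := by
    rw [← Rat.isSquare_intCast_iff]
    refine ⟨y * L ^ 2 / s, ?_⟩
    have hMq : (M : ℚ) ≠ 0 := by exact_mod_cast hM0
    rw [hsq] at h ⊢
    push_cast
    field_simp at h ⊢
    linear_combination -h
  obtain ⟨N, rfl⟩ : e ∣ K := (he.dvd_pow_iff_dvd two_ne_zero).mp ⟨_, by rw [sq, ← hK]⟩
  have hN : e * N ^ 2 = e ^ 2 * M ^ 4 + a * e * M ^ 2 * L ^ 2 + b * L ^ 4 :=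
    mul_left_cancel₀ he.ne_zero (by linear_combination -hK)
  have heL : IsCoprime e L := by
    refine isCoprime_of_prime_dvd (fun h => hL0 h.2) ?_
    rintro q hq ⟨f, rfl⟩ ⟨l, rfl⟩
    have hqf : ¬ q ∣ f := fun ⟨g, hg⟩ => hq.not_isUnit (he q ⟨g, by rw [hg]; ring⟩)
    have h₁ : f * N ^ 2 = q * (f ^ 2 * M ^ 4 + a * f * M ^ 2 * q * l ^ 2 + b * q ^ 2 * l ^ 4) :=
      mul_left_cancel₀ hq.ne_zero (by linear_combination hN)
    obtain ⟨n, rfl⟩ : q ∣ N :=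
      hq.dvd_of_dvd_pow ((hq.dvd_or_dvd ⟨_, h₁⟩).resolve_left hqf)
    have h₂ : q ∣ f ^ 2 * M ^ 4 := by
      refine ⟨f * n ^ 2 - a * f * M ^ 2 * l ^ 2 - b * q * l ^ 4,
        mul_left_cancel₀ hq.ne_zero ?_⟩
      linear_combination -h₁
    rcases hq.dvd_or_dvd h₂ with h₃ | h₃
    · exact hqf (hq.dvd_of_dvd_pow h₃)
    · exact hq.not_isUnit (hML.isUnit_of_dvd' (hq.dvd_of_dvd_pow h₃) (dvd_mul_right q l))
  refine ⟨e, M, L, N, he, ?_, hM0, hL0, hML, heL, by rw [hsq], hN⟩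
  refine (heL.pow_right (n := 4)).dvd_of_dvd_mul_right ⟨N ^ 2 - e * M ^ 4 - a * M ^ 2 * L ^ 2, ?_⟩
  linear_combination -hN

/-- Clearing denominators in a product of two quadratic polynomials in `s²` that is a square. -/
lemma exists_int_of_mul_eq_sq {α β γ δ : ℤ} {s r : ℚ}
    (h : (α * s ^ 2 + β) * (γ * s ^ 2 + δ) = r ^ 2) :
    ∃ M L N : ℤ, IsCoprime M L ∧
      (α * M ^ 2 + β * L ^ 2) * (γ * M ^ 2 + δ * L ^ 2) = N ^ 2 := by
  obtain ⟨M, hM⟩ : ∃ M, M = s.num := ⟨_, rfl⟩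
  obtain ⟨L, hL⟩ : ∃ L : ℤ, L = s.den := ⟨_, rfl⟩
  have hL0 : L ≠ 0 := by rw [hL]; exact_mod_cast s.den_ne_zero
  have hLq : (L : ℚ) ≠ 0 := by exact_mod_cast hL0
  have hML : IsCoprime M L := by
    rw [hM, hL, Int.isCoprime_iff_nat_coprime]
    simpa using s.reduced
  have hsq : s = M / L := by rw [hM, hL]; exact_mod_cast (Rat.num_div_den s).symm
  obtain ⟨N, hN⟩ : IsSquare ((α * M ^ 2 + β * L ^ 2) * (γ * M ^ 2 + δ * L ^ 2)) := by
    rw [← Rat.isSquare_intCast_iff]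
    refine ⟨r * L ^ 2, ?_⟩
    rw [hsq] at h
    push_cast
    field_simp at h
    linear_combination h
  exact ⟨M, L, N, hML, by rw [hN, sq]⟩

end Quartic

section Local

variable {M L N e d p : ℤ}

lemma not_dvd_both {q : ℤ} (hq : Prime q) (hML : IsCoprime M L) (h : q ∣ M) (h' : q ∣ L) : False :=
  hq.not_isUnit (hML.isUnit_of_dvd' h h')

lemma cast_zmod_three (k : ℤ) : (k : ZMod 3) = 0 ↔ 3 ∣ k := by
  simpa using ZMod.intCast_zmod_eq_zero_iff_dvd k 3

lemma cast_zmod_five (k : ℤ) : (k : ZMod 5) = 0 ↔ 5 ∣ k := by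
  simpa using ZMod.intCast_zmod_eq_zero_iff_dvd k 5

lemma two_dvd_of_cast_zmod_eight {k : ℤ} (h : 4 * (k : ZMod 8) = 0) : 2 ∣ k := by
  have : ((4 * k : ℤ) : ZMod 8) = 0 := by push_cast; exact h
  rw [ZMod.intCast_zmod_eq_zero_iff_dvd] at this
  push_cast at this
  omega

/-- Local obstruction at `3` for `d` prime to `3`. -/
lemma quartic_three (hML : IsCoprime M L) (he : (e : ZMod 3) = 2) (hd : (d : ZMod 3) ≠ 0)
    (h : e * N ^ 2 = e ^ 2 * M ^ 4 - 7 * d * e * M ^ 2 * L ^ 2 + 16 * d ^ 2 * L ^ 4) : False := by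
  have h₁ : 4 * e * N ^ 2 = (2 * e * M ^ 2 - 7 * d * L ^ 2) ^ 2 + 15 * d ^ 2 * L ^ 4 := by
    linear_combination 4 * h
  obtain ⟨t, ht⟩ : ∃ t, t = 2 * e * M ^ 2 - 7 * d * L ^ 2 := ⟨_, rfl⟩
  rw [← ht] at h₁
  have h₂ := congrArg (Int.cast : ℤ → ZMod 3) h₁
  push_cast at h₂
  rw [he, show (15 : ZMod 3) = 0 from rfl] at h₂
  have key : ∀ n t : ZMod 3, 4 * 2 * n ^ 2 = t ^ 2 → n = 0 ∧ t = 0 := by decide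
  obtain ⟨hn, ht0⟩ := key N t (by linear_combination h₂)
  obtain ⟨n, rfl⟩ := (cast_zmod_three _).mp hn
  obtain ⟨t, rfl⟩ := (cast_zmod_three _).mp ht0
  have h₃ : 5 * d ^ 2 * L ^ 4 = 3 * (4 * e * n ^ 2 - t ^ 2) := by linarith
  have h₄ := congrArg (Int.cast : ℤ → ZMod 3) h₃
  have h₅ := congrArg (Int.cast : ℤ → ZMod 3) ht
  push_cast at h₄ h₅
  rw [show (3 : ZMod 3) = 0 from rfl, zero_mul] at h₄ h₅
  have key₂ : ∀ d l : ZMod 3, d ≠ 0 → 5 * d ^ 2 * l ^ 4 = 0 → l = 0 := by decide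
  have hl := key₂ _ _ hd h₄
  rw [hl, he] at h₅
  have key₃ : ∀ m d : ZMod 3, 0 = 2 * 2 * m ^ 2 - 7 * d * 0 ^ 2 → m = 0 := by decide
  exact not_dvd_both Int.prime_three hML ((cast_zmod_three _).mp (key₃ _ _ h₅))
    ((cast_zmod_three _).mp hl)

/-- Local obstruction at `3` for `d = -15p` and `e` prime to `3`. -/
lemma quartic_three' (hML : IsCoprime M L) (he : (e : ZMod 3) = 2) (hp : (p : ZMod 3) ≠ 0)
    (h : e * N ^ 2 = e ^ 2 * M ^ 4 + 105 * p * e * M ^ 2 * L ^ 2 + 3600 * p ^ 2 * L ^ 4) :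
    False := by
  have h₂ := congrArg (Int.cast : ℤ → ZMod 3) h
  push_cast at h₂
  rw [he, show (105 : ZMod 3) = 0 from rfl, show (3600 : ZMod 3) = 0 from rfl] at h₂
  have key : ∀ n m : ZMod 3, 2 * n ^ 2 = 2 ^ 2 * m ^ 4 → n = 0 ∧ m = 0 := by decide
  obtain ⟨hn, hm⟩ := key N M (by linear_combination h₂)
  obtain ⟨n, rfl⟩ := (cast_zmod_three _).mp hn
  obtain ⟨m, rfl⟩ := (cast_zmod_three _).mp hm
  have h₃ : e * n ^ 2 = 9 * e ^ 2 * m ^ 4 + 105 * p * e * m ^ 2 * L ^ 2 + 400 * p ^ 2 * L ^ 4 := by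
    linarith
  have h₄ := congrArg (Int.cast : ℤ → ZMod 3) h₃
  push_cast at h₄
  rw [he, show (105 : ZMod 3) = 0 from rfl, show (9 : ZMod 3) = 0 from rfl] at h₄
  have key₂ : ∀ n p l : ZMod 3, p ≠ 0 → 2 * n ^ 2 = 400 * p ^ 2 * l ^ 4 → l = 0 := by decide
  exact not_dvd_both Int.prime_three hML (dvd_mul_right 3 m)
    ((cast_zmod_three _).mp (key₂ n p L hp (by linear_combination h₄)))

/-- Local obstruction at `2` for `e = 2p`, where `d = p` or `d = -15p`; the factor `2p` is divided
out. -/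
lemma quartic_two {u v : ℤ} (hML : IsCoprime M L) (hp : (p : ZMod 8) = 7) (hu : (u : ZMod 8) = 1)
    (hv : (v : ZMod 8) = 1)
    (h : N ^ 2 = p * (2 * M ^ 4 + u * M ^ 2 * L ^ 2 + 8 * v * L ^ 4)) : False := by
  have h₁ := congrArg (Int.cast : ℤ → ZMod 8) h
  push_cast at h₁
  rw [hp, hu, hv, show (8 : ZMod 8) = 0 from rfl] at h₁
  have key : ∀ m n l : ZMod 8, n ^ 2 = 7 * (2 * m ^ 4 + 1 * m ^ 2 * l ^ 2 + 0 * 1 * l ^ 4) →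
    4 * m = 0 ∧ 4 * n = 0 := by decide
  obtain ⟨hm, hn⟩ := key _ _ _ h₁
  obtain ⟨m, rfl⟩ := two_dvd_of_cast_zmod_eight hm
  obtain ⟨n, rfl⟩ := two_dvd_of_cast_zmod_eight hn
  have h₂ : n ^ 2 = p * (8 * m ^ 4 + u * m ^ 2 * L ^ 2 + 2 * v * L ^ 4) := by linarith
  have h₃ := congrArg (Int.cast : ℤ → ZMod 8) h₂
  push_cast at h₃
  rw [hp, hu, hv, show (8 : ZMod 8) = 0 from rfl] at h₃
  have key₂ : ∀ m n l : ZMod 8, n ^ 2 = 7 * (0 * m ^ 4 + 1 * m ^ 2 * l ^ 2 + 2 * 1 * l ^ 4) →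
    4 * l = 0 := by decide
  exact not_dvd_both Int.prime_two hML (dvd_mul_right 2 m) (two_dvd_of_cast_zmod_eight (key₂ _ _ _ h₃))

/-- For `d = -15p` the class `e` is prime to `5`: otherwise the quartic degenerates modulo `5` to the
square of a quadratic form, which forces `p` to be a square modulo `5`. -/
lemma not_five_dvd (he : Squarefree e) (heL : IsCoprime e L) (hp : ¬ IsSquare (p : ZMod 5))
    (h : e * N ^ 2 = e ^ 2 * M ^ 4 + 105 * p * e * M ^ 2 * L ^ 2 + 3600 * p ^ 2 * L ^ 4) :
    ¬ 5 ∣ e := by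
  have h5 : Prime (5 : ℤ) := Nat.prime_iff_prime_int.mp Nat.prime_five
  rintro ⟨f, rfl⟩
  have hf : ¬ 5 ∣ f := fun ⟨g, hg⟩ => h5.not_isUnit (he 5 ⟨g, by rw [hg]; ring⟩)
  have h₁ : f * N ^ 2 = 5 * (f ^ 2 * M ^ 4 + 21 * p * f * M ^ 2 * L ^ 2 + 144 * p ^ 2 * L ^ 4) := by
    linarith
  obtain ⟨n, rfl⟩ : 5 ∣ N := h5.dvd_of_dvd_pow ((h5.dvd_or_dvd ⟨_, h₁⟩).resolve_left hf)
  have h₂ : (f * M ^ 2 + 3 * p * L ^ 2) ^ 2 =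
      5 * (f * n ^ 2 - 3 * p * f * M ^ 2 * L ^ 2 - 27 * p ^ 2 * L ^ 4) := by
    linarith
  obtain ⟨t, ht⟩ := h5.dvd_of_dvd_pow ⟨_, h₂⟩
  rw [ht] at h₂
  have h₃ : f * n ^ 2 = 5 * t ^ 2 + 3 * p * f * M ^ 2 * L ^ 2 + 27 * p ^ 2 * L ^ 4 := by linarith
  have h₄ := congrArg (Int.cast : ℤ → ZMod 5) ht
  have h₅ := congrArg (Int.cast : ℤ → ZMod 5) h₃
  push_cast at h₄ h₅
  have z5 : (5 : ZMod 5) = 0 := rfl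
  have hL : (L : ZMod 5) ≠ 0 := fun h0 => not_dvd_both h5 heL ⟨f, rfl⟩ ((cast_zmod_five _).mp h0)
  have hp0 : (p : ZMod 5) ≠ 0 := fun h0 => hp (by rw [h0]; exact ⟨0, by simp⟩)
  have hA : (f * M ^ 2 : ZMod 5) = 2 * p * L ^ 2 := by
    linear_combination h₄ + (t - p * L ^ 2 : ZMod 5) * z5
  have hB : (f * n ^ 2 : ZMod 5) = 3 * p ^ 2 * L ^ 4 := by
    linear_combination h₅ + (3 * p * L ^ 2 : ZMod 5) * hA + (t ^ 2 + 6 * p ^ 2 * L ^ 4 : ZMod 5) * z5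
  have : Fact (Nat.Prime 5) := ⟨Nat.prime_five⟩
  refine hp ⟨(f * M * n : ZMod 5) / (p * L ^ 3), ?_⟩
  field_simp
  linear_combination -(f * n ^ 2 : ZMod 5) * hA - (2 * p * L ^ 2 : ZMod 5) * hB -
    (p ^ 3 * L ^ 6 : ZMod 5) * z5

/-- For `d = -15p` the class `e` is prime to `3`: otherwise the quartic degenerates modulo `3` to the
square of a quadratic form, which forces `p` to be a square modulo `3`. -/
lemma not_three_dvd (he : Squarefree e) (heL : IsCoprime e L) (hp : (p : ZMod 3) = 2)
    (h : e * N ^ 2 = e ^ 2 * M ^ 4 + 105 * p * e * M ^ 2 * L ^ 2 + 3600 * p ^ 2 * L ^ 4) :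
    ¬ 3 ∣ e := by
  have h3 : Prime (3 : ℤ) := Int.prime_three
  rintro ⟨f, rfl⟩
  have hf : ¬ 3 ∣ f := fun ⟨g, hg⟩ => h3.not_isUnit (he 3 ⟨g, by rw [hg]; ring⟩)
  have h₁ : f * N ^ 2 = 3 * (f ^ 2 * M ^ 4 + 35 * p * f * M ^ 2 * L ^ 2 + 400 * p ^ 2 * L ^ 4) := by
    linarith
  obtain ⟨n, rfl⟩ : 3 ∣ N := h3.dvd_of_dvd_pow ((h3.dvd_or_dvd ⟨_, h₁⟩).resolve_left hf)
  have h₂ : (f * M ^ 2 + p * L ^ 2) ^ 2 =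
      3 * (f * n ^ 2 - 11 * p * f * M ^ 2 * L ^ 2 - 133 * p ^ 2 * L ^ 4) := by
    linarith
  obtain ⟨t, ht⟩ := h3.dvd_of_dvd_pow ⟨_, h₂⟩
  rw [ht] at h₂
  have h₃ : f * n ^ 2 = 3 * t ^ 2 + 11 * p * f * M ^ 2 * L ^ 2 + 133 * p ^ 2 * L ^ 4 := by linarith
  have h₄ := congrArg (Int.cast : ℤ → ZMod 3) ht
  have h₅ := congrArg (Int.cast : ℤ → ZMod 3) h₃
  push_cast at h₄ h₅
  rw [hp, show (3 : ZMod 3) = 0 from rfl] at h₄ h₅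
  have key : ∀ f m n l : ZMod 3, f * m ^ 2 + 2 * l ^ 2 = 0 →
    f * n ^ 2 = 11 * 2 * (f * m ^ 2) * l ^ 2 + 133 * 2 ^ 2 * l ^ 4 → l = 0 := by decide
  have hL := key f M n L (by linear_combination h₄) (by linear_combination h₅)
  exact not_dvd_both h3 heL ⟨f, rfl⟩ ((cast_zmod_three _).mp hL)

/-- Local obstruction at a prime `p` dividing the twisting parameter exactly once: a
first reduction modulo `p` shows that `p` divides `M` and `N`, a second one that it divides `L`. -/
lemma mul_ne_sq_of_prime {q : ℕ} (hq : q.Prime) {κ μ c : ℤ} (hML : IsCoprime M L)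
    (hκ : ¬ IsSquare (κ : ZMod q)) (hμ : ¬ IsSquare (-μ : ZMod q)) (hc : (c : ZMod q) ≠ 0)
    (h : (-1 * M ^ 2 + κ * (q * c) * L ^ 2) * (μ * M ^ 2 + (q * c) * L ^ 2) = N ^ 2) : False := by
  have : Fact q.Prime := ⟨hq⟩
  have hq' : Prime (q : ℤ) := Nat.prime_iff_prime_int.mp hq
  have hq0 : ((q : ℤ) : ZMod q) = 0 := by simp
  have key : ∀ a x y : ZMod q, ¬ IsSquare a → a * x ^ 2 = y ^ 2 → x = 0 := by
    intro a x y ha hxy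
    by_contra hx
    exact ha ⟨y / x, by field_simp; linear_combination hxy⟩
  have h₁ := congrArg (Int.cast : ℤ → ZMod q) h
  push_cast at h₁
  rw [CharP.cast_eq_zero] at h₁
  have hM := key _ ((M : ZMod q) ^ 2) N hμ (by linear_combination h₁)
  have hM' : (q : ℤ) ∣ M := by
    rw [← ZMod.intCast_zmod_eq_zero_iff_dvd]
    exact pow_eq_zero_iff two_ne_zero |>.mp hM
  have hN' : (q : ℤ) ∣ N := by
    rw [← ZMod.intCast_zmod_eq_zero_iff_dvd]
    refine pow_eq_zero_iff two_ne_zero |>.mp (?_ : (N : ZMod q) ^ 2 = 0)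
    linear_combination -h₁ - μ * (M : ZMod q) ^ 2 * hM
  obtain ⟨m, rfl⟩ := hM'
  obtain ⟨n, rfl⟩ := hN'
  have h₂ : (-1 * q * m ^ 2 + κ * c * L ^ 2) * (μ * q * m ^ 2 + c * L ^ 2) = n ^ 2 :=
    mul_left_cancel₀ (pow_ne_zero 2 hq'.ne_zero) (by linear_combination h)
  have h₃ := congrArg (Int.cast : ℤ → ZMod q) h₂
  push_cast at h₃
  rw [CharP.cast_eq_zero] at h₃
  have hL := key _ (c * (L : ZMod q) ^ 2) n hκ (by linear_combination h₃)
  refine not_dvd_both hq' hML (dvd_mul_right _ m) ?_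
  rw [← ZMod.intCast_zmod_eq_zero_iff_dvd]
  exact pow_eq_zero_iff two_ne_zero |>.mp ((mul_eq_zero.mp hL).resolve_left hc)

end Local

/-! ### Obstructions at 2 and classes of the second descent -/

section TwoAdic

variable {M L N d : ℤ}

lemma exists_odd_sq (h : ¬ 2 ∣ M) : ∃ i, M ^ 2 = 8 * i + 1 := by
  obtain ⟨m, rfl⟩ : ∃ m, M = 2 * m + 1 := ⟨M / 2, by omega⟩
  obtain ⟨i, hi⟩ := Int.even_mul_succ_self m
  exact ⟨i, by linear_combination 4 * hi⟩

lemma two_dvd_iff_cast_zmod_four (k : ℤ) : 2 ∣ k ↔ 2 * (k : ZMod 4) = 0 := by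
  have : 2 * (k : ZMod 4) = ((2 * k : ℤ) : ZMod 4) := by push_cast; rfl
  rw [this, ZMod.intCast_zmod_eq_zero_iff_dvd]
  push_cast
  omega

/-- Coprime integers of equal parity are both odd. -/
lemma odd_of_coprime (hML : IsCoprime M L)
    (h : 2 * (M : ZMod 4) = 0 ↔ 2 * (L : ZMod 4) = 0) : ¬ 2 ∣ M ∧ ¬ 2 ∣ L := by
  rw [← two_dvd_iff_cast_zmod_four, ← two_dvd_iff_cast_zmod_four] at h
  by_contra hc
  have : 2 ∣ M := by tauto
  exact not_dvd_both Int.prime_two hML this (h.mp this)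

/-- Excludes the class `3` of the second descent for `d ≡ 7` modulo `8`. -/
lemma mul_ne_sq_two (hML : IsCoprime M L) (hd : ∃ k, d = 8 * k + 7)
    (h : (1 * M ^ 2 + 5 * d * L ^ 2) * (3 * M ^ 2 + -d * L ^ 2) = N ^ 2) : False := by
  obtain ⟨k, rfl⟩ := hd
  have h₁ := congrArg (Int.cast : ℤ → ZMod 4) h
  push_cast at h₁
  rw [show (8 : ZMod 4) = 0 from rfl, zero_mul] at h₁
  have key : ∀ m l n : ZMod 4, (1 * m ^ 2 + 5 * (0 + 7) * l ^ 2) *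
      (3 * m ^ 2 + -(0 + 7) * l ^ 2) = n ^ 2 → (2 * m = 0 ↔ 2 * l = 0) := by decide
  obtain ⟨hM, hL⟩ := odd_of_coprime hML (key _ _ _ h₁)
  obtain ⟨i, hi⟩ := exists_odd_sq hM
  obtain ⟨j, hj⟩ := exists_odd_sq hL
  rw [hi, hj] at h
  -- Both factors are `4` times an odd number.
  obtain ⟨n, rfl⟩ : 4 ∣ N := by
    rw [← Int.pow_dvd_pow_iff two_ne_zero]
    exact ⟨(2 * (i + 5 * k * (8 * j + 1) + 35 * j) + 9) *
      (2 * (3 * i - k * (8 * j + 1) - 7 * j) - 1), by linear_combination -h⟩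
  have h₂ : n ^ 2 = (2 * (i + 5 * k * (8 * j + 1) + 35 * j) + 9) *
      (2 * (3 * i - k * (8 * j + 1) - 7 * j) - 1) := by linarith
  have h₃ := congrArg (Int.cast : ℤ → ZMod 4) h₂
  push_cast at h₃
  have key₂ : ∀ i j k n : ZMod 4, n ^ 2 = (2 * (i + 5 * k * (8 * j + 1) + 35 * j) + 9) *
      (2 * (3 * i - k * (8 * j + 1) - 7 * j) - 1) → False := by decide
  exact key₂ _ _ _ _ h₃

/-- Excludes the class `3` of the second descent for `d = 1`. -/
lemma mul_ne_sq_two_one (hML : IsCoprime M L)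
    (h : (1 * M ^ 2 + 5 * L ^ 2) * (3 * M ^ 2 + -1 * L ^ 2) = N ^ 2) : False := by
  have h₁ := congrArg (Int.cast : ℤ → ZMod 4) h
  push_cast at h₁
  have key : ∀ m l n : ZMod 4, (1 * m ^ 2 + 5 * l ^ 2) * (3 * m ^ 2 + -1 * l ^ 2) = n ^ 2 →
      (2 * m = 0 ↔ 2 * l = 0) := by decide
  obtain ⟨hM, hL⟩ := odd_of_coprime hML (key _ _ _ h₁)
  obtain ⟨i, hi⟩ := exists_odd_sq hM
  obtain ⟨j, hj⟩ := exists_odd_sq hL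
  rw [hi, hj] at h
  obtain ⟨n, rfl⟩ : 2 ∣ N := by
    rw [← Int.pow_dvd_pow_iff two_ne_zero]
    exact ⟨(4 * i + 20 * j + 3) * (12 * i - 4 * j + 1), by linear_combination -h⟩
  have h₂ : n ^ 2 = (4 * i + 20 * j + 3) * (12 * i - 4 * j + 1) := by linarith
  have h₃ := congrArg (Int.cast : ℤ → ZMod 4) h₂
  push_cast at h₃
  have key₂ : ∀ i j n : ZMod 4,
      n ^ 2 = (4 * i + 20 * j + 3) * (12 * i - 4 * j + 1) → False := by decide
  exact key₂ _ _ _ h₃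

/-- Excludes the class `-1` of the second descent for `d = 1`. -/
lemma mul_ne_sq_two_one' (hML : IsCoprime M L)
    (h : (-1 * M ^ 2 + 15 * L ^ 2) * (1 * M ^ 2 + 1 * L ^ 2) = N ^ 2) : False := by
  have h₁ := congrArg (Int.cast : ℤ → ZMod 4) h
  push_cast at h₁
  have key : ∀ m l n : ZMod 4, (-1 * m ^ 2 + 15 * l ^ 2) * (1 * m ^ 2 + 1 * l ^ 2) = n ^ 2 →
      (2 * m = 0 ↔ 2 * l = 0) := by decide
  obtain ⟨hM, hL⟩ := odd_of_coprime hML (key _ _ _ h₁)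
  obtain ⟨i, hi⟩ := exists_odd_sq hM
  obtain ⟨j, hj⟩ := exists_odd_sq hL
  rw [hi, hj] at h
  obtain ⟨n, rfl⟩ : 2 ∣ N := by
    rw [← Int.pow_dvd_pow_iff two_ne_zero]
    exact ⟨(60 * j - 4 * i + 7) * (4 * i + 4 * j + 1), by linear_combination -h⟩
  have h₂ : n ^ 2 = (60 * j - 4 * i + 7) * (4 * i + 4 * j + 1) := by linarith
  have h₃ := congrArg (Int.cast : ℤ → ZMod 4) h₂
  push_cast at h₃
  have key₂ : ∀ i j n : ZMod 4,
      n ^ 2 = (60 * j - 4 * i + 7) * (4 * i + 4 * j + 1) → False := by decide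
  exact key₂ _ _ _ h₃

end TwoAdic

namespace twistModel

/-- The class of `g` modulo squares is hit by the second descent map: there is a point with
`X = gs²` on `Y² = X(X + 15d)(X - d)` whose `Y`-coordinate is `2wX` with `w ≠ 0`. -/
def HasClass (d g : ℚ) : Prop :=
  ∃ s w : ℚ, s ≠ 0 ∧ w ≠ 0 ∧
    (g * s ^ 2 + 15 * d) * (g * s ^ 2 - d) = 4 * w ^ 2 * (g * s ^ 2)

variable {d g : ℚ}

/-- Translation by the `2`-torsion point `(0, 0)` multiplies the class by `-15`. -/
lemma HasClass.neg_fifteen_mul (hd : d ≠ 0) (hg : g ≠ 0) (h : HasClass d g) :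
    HasClass d (-15 * g) := by
  obtain ⟨s, w, hs, hw, h⟩ := h
  refine ⟨d / (g * s), w, by positivity, hw, ?_⟩
  field_simp
  linear_combination -h

/-- Translation by the `2`-torsion point `(d, 0)` multiplies the class by `d`. -/
lemma HasClass.mul_d (hd : d ≠ 0) (hg : g ≠ 0) (h : HasClass d g) : HasClass d (d * g) := by
  obtain ⟨s, w, hs, hw, h⟩ := h
  obtain ⟨X, hX⟩ : ∃ X, X = g * s ^ 2 := ⟨_, rfl⟩
  rw [← hX] at h
  have hX0 : X ≠ 0 := by rw [hX]; positivity
  have hXd : X - d ≠ 0 := by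
    intro h0
    rw [h0, mul_zero] at h
    exact mul_ne_zero (by positivity) hX0 h.symm
  have e : d * g * (2 * w * s / (X - d)) ^ 2 = d * (X + 15 * d) / (X - d) := by
    rw [div_pow, ← mul_div_assoc, div_eq_div_iff (pow_ne_zero 2 hXd) hXd]
    linear_combination (-d * (X - d)) * h - 4 * d * w ^ 2 * (X - d) * hX
  refine ⟨2 * w * s / (X - d), 4 * d / w, div_ne_zero (by positivity) hXd, by positivity, ?_⟩
  rw [e]
  field_simp
  linear_combination -64 * d * h

lemma HasClass.of_mul_sq {k : ℚ} (hk : k ≠ 0) (h : HasClass d (g * k ^ 2)) : HasClass d g := by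
  obtain ⟨s, w, hs, hw, h⟩ := h
  refine ⟨k * s, w, mul_ne_zero hk hs, hw, ?_⟩
  linear_combination h

end twistModel

/-! ### The descents for the twists by 1, p and -15p -/

section Residues

variable {q : ℕ}

lemma not_isSquare_neg_one (h8 : q % 8 = 7) [Fact q.Prime] : ¬ IsSquare (-1 : ZMod q) := by
  rw [ZMod.exists_sq_eq_neg_one_iff]; omega

lemma isSquare_three [Fact q.Prime] (h8 : q % 8 = 7) (h3 : q % 3 = 2) : IsSquare (3 : ZMod q) := by
  have h2 : ¬ IsSquare ((2 : ℕ) : ZMod 3) := by decide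
  have : Fact (Nat.Prime 3) := ⟨Nat.prime_three⟩
  have h := ZMod.exists_sq_eq_prime_iff_of_mod_four_eq_three (p := q) (q := 3) (by omega) (by omega)
    (by omega)
  push_cast at h
  rw [h, ← ZMod.natCast_mod, h3]
  exact h2

lemma not_isSquare_neg_three [Fact q.Prime] (h8 : q % 8 = 7) (h3 : q % 3 = 2) :
    ¬ IsSquare (-3 : ZMod q) := by
  have h30 : (3 : ZMod q) ≠ 0 := by
    have : ((3 : ℕ) : ZMod q) ≠ 0 := by
      rw [Ne, ZMod.natCast_eq_zero_iff]
      intro h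
      have := Nat.le_of_dvd (by norm_num) h
      interval_cases q <;> omega
    exact_mod_cast this
  intro h
  refine not_isSquare_neg_one h8 ?_
  have := h.div (isSquare_three h8 h3)
  rwa [neg_div, div_self h30] at this

lemma not_isSquare_five [Fact q.Prime] (h8 : q % 8 = 7) (h5 : ¬ IsSquare (q : ZMod 5)) :
    ¬ IsSquare (5 : ZMod q) := by
  have : Fact (Nat.Prime 5) := ⟨Nat.prime_five⟩
  have h := ZMod.exists_sq_eq_prime_iff_of_mod_four_eq_one (p := 5) (q := q) (by norm_num)
    (by omega)
  push_cast at h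
  rwa [← h]

lemma not_isSquare_fifteen [Fact q.Prime] (h8 : q % 8 = 7) (h3 : q % 3 = 2)
    (h5 : ¬ IsSquare (q : ZMod 5)) : ¬ IsSquare (15 : ZMod q) := by
  have h30 : (3 : ZMod q) ≠ 0 := fun h =>
    not_isSquare_neg_three h8 h3 (by rw [h, neg_zero]; exact ⟨0, by simp⟩)
  intro h
  refine not_isSquare_five h8 h5 ?_
  have := h.div (isSquare_three h8 h3)
  rwa [show (15 : ZMod q) = 5 * 3 by norm_num, mul_div_cancel_right₀ _ h30] at this

end Residues

namespace twistModel

/-- If the first descent leaves no class but the trivial one, all nonzero `x`-coordinates are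
squares. Only positive classes matter, as `x² - 7dx + 16d²` is positive. -/
lemma exists_eq_sq (d : ℤ) (hd : d ≠ 0)
    (H : ∀ e M L N : ℤ, 0 < e → Squarefree e → e ∣ 16 * d ^ 2 → IsCoprime M L → IsCoprime e L →
      e * N ^ 2 = e ^ 2 * M ^ 4 + (-7 * d) * e * M ^ 2 * L ^ 2 + (16 * d ^ 2) * L ^ 4 → e = 1)
    {x y : ℚ} (hx : x ≠ 0) (h : y ^ 2 = x * (x ^ 2 - 7 * d * x + 16 * d ^ 2)) :
    ∃ w, x = w ^ 2 := by
  obtain ⟨e, M, L, N, he, heb, hM, hL, hML, heL, hxe, hN⟩ :=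
    exists_quartic (a := -7 * d) (b := 16 * d ^ 2) (y := y) hx (by push_cast; linear_combination h)
  have hd' : (d : ℚ) ≠ 0 := by exact_mod_cast hd
  have hpos : 0 < x ^ 2 - 7 * d * x + 16 * d ^ 2 := by
    have : 0 < (d : ℚ) ^ 2 := by positivity
    nlinarith [sq_nonneg (2 * x - 7 * d)]
  have hx0 : 0 < x := by
    refine lt_of_le_of_ne ?_ hx.symm
    exact nonneg_of_mul_nonneg_left (h ▸ sq_nonneg y) hpos
  have he0 : 0 < e := by
    have : (0 : ℚ) < e := pos_of_mul_pos_left (hxe ▸ hx0) (sq_nonneg _)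
    exact_mod_cast this
  have he1 := H e M L N he0 he heb hML heL hN
  exact ⟨M / L, by rw [hxe, he1]; push_cast; ring⟩

lemma eq_of_dvd_two_mul {q : ℕ} (hq : q.Prime) {e : ℤ} (he0 : 0 < e) (he : e ∣ 2 * q) :
    e = 1 ∨ e = 2 ∨ e = q ∨ e = 2 * q := by
  lift e to ℕ using he0.le
  have he' : e ∣ 2 * q := by exact_mod_cast he
  obtain ⟨a, b, ha, hb, rfl⟩ := exists_dvd_and_dvd_of_dvd_mul he'
  rcases (Nat.dvd_prime Nat.prime_two).mp ha with rfl | rfl <;>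
    rcases (Nat.dvd_prime hq).mp hb with rfl | rfl <;> simp

lemma exists_eq_sq_one {x y : ℚ} (hx : x ≠ 0) (h : y ^ 2 = x * (x ^ 2 - 7 * 1 * x + 16 * 1 ^ 2)) :
    ∃ w, x = w ^ 2 := by
  refine exists_eq_sq 1 one_ne_zero ?_ hx (by exact_mod_cast h)
  intro e M L N he0 he heb hML heL hN
  have h2 : e ∣ 2 := (he.dvd_pow_iff_dvd (n := 4) (by norm_num)).mp (by norm_num at heb ⊢; exact heb)
  have := Int.le_of_dvd two_pos h2
  interval_cases e
  · rfl
  · exact (quartic_three hML (e := 2) (N := N) (d := 1) (by rfl) (by decide) (by linear_combination hN)).elim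

section Prime

variable {q : ℕ}

lemma exists_eq_sq_prime (hq : q.Prime) (h8 : q % 8 = 7) (h3 : q % 3 = 2) {x y : ℚ} (hx : x ≠ 0)
    (h : y ^ 2 = x * (x ^ 2 - 7 * q * x + 16 * q ^ 2)) : ∃ w, x = w ^ 2 := by
  refine exists_eq_sq q (by exact_mod_cast hq.ne_zero) ?_ hx (by exact_mod_cast h)
  intro e M L N he0 he heb hML heL hN
  have hq3 : ((q : ℤ) : ZMod 3) = 2 := by
    rw [Int.cast_natCast, ← ZMod.natCast_mod, h3]; rfl
  have hq8 : ((q : ℤ) : ZMod 8) = 7 := by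
    rw [Int.cast_natCast, ← ZMod.natCast_mod, h8]; rfl
  have hq0 : (q : ℤ) ≠ 0 := by exact_mod_cast hq.ne_zero
  have h2 : e ∣ 2 * q := (he.dvd_pow_iff_dvd (n := 4) (by norm_num)).mp
    (heb.trans ⟨q ^ 2, by ring⟩)
  have hN' : e * N ^ 2 = e ^ 2 * M ^ 4 - 7 * q * e * M ^ 2 * L ^ 2 + 16 * q ^ 2 * L ^ 4 := by
    linear_combination hN
  rcases eq_of_dvd_two_mul hq he0 h2 with rfl | rfl | rfl | rfl
  · rfl
  · exact (quartic_three hML (by rfl) (by rw [hq3]; decide) hN').elim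
  · exact (quartic_three hML hq3 (by rw [hq3]; decide) hN').elim
  · refine (quartic_two hML hq8 (u := -7) (v := 1) (by rfl) (by rfl) (N := N) ?_).elim
    exact mul_left_cancel₀ (mul_ne_zero two_ne_zero hq0) (by linear_combination hN)

lemma exists_eq_sq_neg_fifteen (hq : q.Prime) (h8 : q % 8 = 7) (h3 : q % 3 = 2)
    (h5 : ¬ IsSquare (q : ZMod 5)) {x y : ℚ} (hx : x ≠ 0)
    (h : y ^ 2 = x * (x ^ 2 - 7 * (-15 * q) * x + 16 * (-15 * q) ^ 2)) : ∃ w, x = w ^ 2 := by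
  have hq0 : (q : ℤ) ≠ 0 := by exact_mod_cast hq.ne_zero
  refine exists_eq_sq (-15 * q) (mul_ne_zero (by norm_num) hq0) ?_ hx
    (by push_cast; exact_mod_cast h)
  intro e M L N he0 he heb hML heL hN
  have hq3 : ((q : ℤ) : ZMod 3) = 2 := by
    rw [Int.cast_natCast, ← ZMod.natCast_mod, h3]; rfl
  have hq8 : ((q : ℤ) : ZMod 8) = 7 := by
    rw [Int.cast_natCast, ← ZMod.natCast_mod, h8]; rfl
  have hN' : e * N ^ 2 =
      e ^ 2 * M ^ 4 + 105 * q * e * M ^ 2 * L ^ 2 + 3600 * q ^ 2 * L ^ 4 := by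
    linear_combination hN
  have h30 : e ∣ 15 * (2 * q) := (he.dvd_pow_iff_dvd (n := 4) (by norm_num)).mp
    (heb.trans ⟨225 * q ^ 2, by ring⟩)
  have h15 : IsCoprime e 15 := by
    have c3 : IsCoprime 3 e := (Int.prime_three.coprime_iff_not_dvd).mpr
      (not_three_dvd he heL hq3 hN')
    have c5 : IsCoprime 5 e := ((Nat.prime_iff_prime_int.mp Nat.prime_five).coprime_iff_not_dvd).mpr
      (not_five_dvd he heL (by simpa using h5) hN')
    simpa using (c3.mul_left c5).symm
  rcases eq_of_dvd_two_mul hq he0 (h15.dvd_of_dvd_mul_left h30) with rfl | rfl | rfl | rfl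
  · rfl
  · exact (quartic_three' hML (by rfl) (by rw [hq3]; decide) hN').elim
  · exact (quartic_three' hML hq3 (by rw [hq3]; decide) hN').elim
  · refine (quartic_two hML hq8 (u := 105) (v := 225) (by rfl) (by rfl) (N := N) ?_).elim
    exact mul_left_cancel₀ (mul_ne_zero two_ne_zero hq0) (by linear_combination hN)

end Prime

section Classes

/-- Every point on `Y² = X(X + 15d)(X - d)` with `Y ≠ 0` realizes the class of a squarefree divisor
of `15d²`. -/
lemma exists_class (d : ℤ) {X w : ℚ} (hX : X ≠ 0) (hw : w ≠ 0)
    (h : (X + 15 * d) * (X - d) = 4 * w ^ 2 * X) :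
    ∃ (e : ℤ) (s : ℚ), Squarefree e ∧ e ∣ 15 * d ^ 2 ∧ X = e * s ^ 2 ∧ HasClass d e := by
  obtain ⟨e, M, L, -, he, heb, hM, hL, -, -, hxe, -⟩ :=
    exists_quartic (a := 14 * d) (b := -15 * d ^ 2) (y := 2 * w * X) hX
      (by push_cast; linear_combination -X * h)
  have hM' : (M : ℚ) ≠ 0 := by exact_mod_cast hM
  have hL' : (L : ℚ) ≠ 0 := by exact_mod_cast hL
  exact ⟨e, M / L, he, (dvd_neg.mpr heb).trans (dvd_of_eq (by ring)), hxe, M / L, w,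
    div_ne_zero hM' hL', hw, by rw [← hxe]; exact h⟩

/-- A class `g` is excluded if the homogeneous form of its equation, with a factor `g` divided out,
has no solution in coprime integers. -/
lemma not_hasClass_of_int {α β γ δ : ℤ} {d g : ℚ}
    (hc : ∀ s : ℚ, (α * s ^ 2 + β) * (γ * s ^ 2 + δ) * g =
      (g * s ^ 2 + 15 * d) * (g * s ^ 2 - d)) (hg : g ≠ 0)
    (H : ∀ M L N : ℤ, IsCoprime M L →
      (α * M ^ 2 + β * L ^ 2) * (γ * M ^ 2 + δ * L ^ 2) = N ^ 2 → False) : ¬ HasClass d g := by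
  rintro ⟨s, w, -, -, h⟩
  have : (α * s ^ 2 + β) * (γ * s ^ 2 + δ) = (2 * w * s) ^ 2 := by
    refine mul_right_cancel₀ hg ?_
    rw [hc, h]
    ring
  obtain ⟨M, L, N, hML, hN⟩ := exists_int_of_mul_eq_sq this
  exact H M L N hML hN

lemma not_hasClass_one_neg_one : ¬ HasClass 1 (-1) :=
  not_hasClass_of_int (α := -1) (β := 15) (γ := 1) (δ := 1) (fun s => by push_cast; ring)
    (by norm_num) fun _ _ _ => mul_ne_sq_two_one'

lemma not_hasClass_one_three : ¬ HasClass 1 3 :=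
  not_hasClass_of_int (α := 1) (β := 5) (γ := 3) (δ := -1) (fun s => by push_cast; ring)
    (by norm_num) fun _ _ _ => mul_ne_sq_two_one

variable {q : ℕ} {c : ℤ}

lemma not_hasClass_neg_one (hq : q.Prime) (h8 : q % 8 = 7) (h3 : q % 3 = 2)
    (h5 : ¬ IsSquare (q : ZMod 5)) (hc : (c : ZMod q) ≠ 0) :
    ¬ HasClass ((q * c : ℤ) : ℚ) (-1) := by
  have : Fact q.Prime := ⟨hq⟩
  refine not_hasClass_of_int (α := -1) (β := 15 * (q * c)) (γ := 1) (δ := q * c)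
    (fun s => by push_cast; ring) (by norm_num) fun M L N hML hN => ?_
  exact mul_ne_sq_of_prime hq hML (κ := 15) (μ := 1)
    (by simpa using not_isSquare_fifteen h8 h3 h5) (by simpa using not_isSquare_neg_one h8) hc hN

lemma not_hasClass_neg_three (hq : q.Prime) (h8 : q % 8 = 7) (h3 : q % 3 = 2)
    (h5 : ¬ IsSquare (q : ZMod 5)) (hc : (c : ZMod q) ≠ 0) :
    ¬ HasClass ((q * c : ℤ) : ℚ) (-3) := by
  have : Fact q.Prime := ⟨hq⟩
  refine not_hasClass_of_int (α := -1) (β := 5 * (q * c)) (γ := 3) (δ := q * c)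
    (fun s => by push_cast; ring) (by norm_num) fun M L N hML hN => ?_
  exact mul_ne_sq_of_prime hq hML (κ := 5) (μ := 3)
    (by simpa using not_isSquare_five h8 h5) (by simpa using not_isSquare_neg_three h8 h3) hc hN

lemma not_hasClass_three {d : ℤ} (hd : ∃ k, d = 8 * k + 7) : ¬ HasClass d 3 :=
  not_hasClass_of_int (α := 1) (β := 5 * d) (γ := 3) (δ := -d)
    (fun s => by push_cast; ring) (by norm_num) fun _ _ _ hML => mul_ne_sq_two hML hd

end Classes

section Finiteness

lemma finite_one : Finite (twistModel 1).toAffine.Point := by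
  refine finite_of_classes_one (fun x y => exists_eq_sq_one) fun X w hX hw h => ?_
  obtain ⟨e, s, he, he15, hXe, hcl⟩ := exists_class 1 hX hw (by exact_mod_cast h)
  have n₁ := not_hasClass_one_neg_one
  have n₃ := not_hasClass_one_three
  have key : ∀ g : ℚ, g ≠ 0 → HasClass 1 g → HasClass 1 (-15 * g) :=
    fun g hg h => h.neg_fifteen_mul one_ne_zero hg
  have hnat : e.natAbs ∈ ({1, 3, 5, 15} : Finset ℕ) := by
    have : e.natAbs ∈ Nat.divisors 15 := by
      rw [Nat.mem_divisors]
      exact ⟨Int.natAbs_dvd_natAbs.mpr (by simpa using he15), by norm_num⟩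
    exact this
  refine ⟨s, ?_⟩
  simp only [Finset.mem_insert, Finset.mem_singleton, Int.natAbs_eq_iff] at hnat
  rcases hnat with (rfl | rfl) | (rfl | rfl) | (rfl | rfl) | (rfl | rfl) <;> push_cast at hXe hcl
  · exact Or.inl (by rw [hXe, one_mul])
  · exact absurd hcl n₁
  · exact absurd hcl n₃
  · exact Or.inr (Or.inr (Or.inr hXe))
  · exact Or.inr (Or.inr (Or.inl hXe))
  · refine absurd (HasClass.of_mul_sq (k := 5) (by norm_num) ?_) n₃
    convert key _ (by norm_num) hcl using 1; norm_num
  · refine absurd (HasClass.of_mul_sq (k := 15) (by norm_num) ?_) n₁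
    convert key _ (by norm_num) hcl using 1; norm_num
  · exact Or.inr (Or.inl hXe)

/-- The second descent on the twists by `q` and by `-15q`: modulo the classes `-15` and `q` of the
`2`-torsion points only `-1` and `±3` have to be excluded. -/
lemma exists_class_trivial {q : ℕ} (hq : q.Prime) {d : ℤ} (hd : d ≠ 0) (hd15 : d ∣ 15 * q)
    (n₁ : ¬ HasClass d (-1)) (n₃ : ¬ HasClass d 3) (n₃' : ¬ HasClass d (-3))
    (hmul : ∀ g : ℚ, g ≠ 0 → HasClass d (q * g) → HasClass d g) {X w : ℚ} (hX : X ≠ 0)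
    (hw : w ≠ 0) (h : (X + 15 * d) * (X - d) = 4 * w ^ 2 * X) :
    ∃ s, X = s ^ 2 ∨ X = -15 * s ^ 2 ∨ X = q * s ^ 2 ∨ X = -15 * q * s ^ 2 := by
  have hd' : (d : ℚ) ≠ 0 := by exact_mod_cast hd
  obtain ⟨e, s, he, hed, hXe, hcl⟩ := exists_class d hX hw h
  have key : ∀ g : ℚ, g ≠ 0 → HasClass d g → HasClass d (-15 * g) :=
    fun g hg h => h.neg_fifteen_mul hd' hg
  have n₁₅ : ¬ HasClass d 15 := fun h => by
    refine n₁ (HasClass.of_mul_sq (k := 15) (by norm_num) ?_)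
    convert key _ (by norm_num) h using 1; norm_num
  have n₅ : ¬ HasClass d 5 := fun h => by
    refine n₃' (HasClass.of_mul_sq (k := 5) (by norm_num) ?_)
    convert key _ (by norm_num) h using 1; norm_num
  have n₅' : ¬ HasClass d (-5) := fun h => by
    refine n₃ (HasClass.of_mul_sq (k := 5) (by norm_num) ?_)
    convert key _ (by norm_num) h using 1; norm_num
  have he15 : e ∣ 15 * q := by
    refine (he.dvd_pow_iff_dvd (n := 3) (by norm_num)).mp (hed.trans ?_)
    obtain ⟨c, hc⟩ := hd15
    exact ⟨c ^ 2 * q, by linear_combination 15 * q * (15 * q + d * c) * hc⟩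
  obtain ⟨a, b, ha, hb, hab⟩ := exists_dvd_and_dvd_of_dvd_mul
    (show e.natAbs ∣ 15 * q by simpa [Int.natAbs_mul] using Int.natAbs_dvd_natAbs.mpr he15)
  have ha' : a ∈ ({1, 3, 5, 15} : Finset ℕ) := Nat.mem_divisors.mpr ⟨ha, by norm_num⟩
  simp only [Finset.mem_insert, Finset.mem_singleton] at ha'
  have hb' := (Nat.dvd_prime hq).mp hb
  have he' : e = a * b ∨ e = -(a * b) := by
    rw [Int.natAbs_eq_iff] at hab
    exact_mod_cast hab
  obtain ⟨g, hg, heg⟩ : ∃ g : ℤ, (g = 1 ∨ g = -15 ∨ g = -1 ∨ g = 15 ∨ g = 3 ∨ g = -5 ∨ g = -3 ∨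
      g = 5) ∧ (e = g ∨ e = q * g) := by
    rcases he' with he' | he'
    · exact ⟨a, by omega, by rcases hb' with rfl | rfl <;> simp [he', mul_comm]⟩
    · exact ⟨-a, by omega, by rcases hb' with rfl | rfl <;> simp [he', mul_comm]⟩
  have hg0 : (g : ℚ) ≠ 0 := by
    have : g ≠ 0 := by omega
    exact_mod_cast this
  have hclg : HasClass d g := by
    rcases heg with rfl | rfl
    · exact hcl
    · exact hmul g hg0 (by exact_mod_cast hcl)
  have hXg : X = g * s ^ 2 ∨ X = q * g * s ^ 2 := by
    rcases heg with rfl | rfl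
    · exact Or.inl hXe
    · exact Or.inr (by exact_mod_cast hXe)
  refine ⟨s, ?_⟩
  rcases hg with rfl | rfl | rfl | rfl | rfl | rfl | rfl | rfl <;> push_cast at hclg hXg
  · rcases hXg with h | h
    · exact Or.inl (by rw [h, one_mul])
    · exact Or.inr (Or.inr (Or.inl (by rw [h, mul_one])))
  · rcases hXg with h | h
    · exact Or.inr (Or.inl h)
    · exact Or.inr (Or.inr (Or.inr (by rw [h]; ring)))
  · exact absurd hclg n₁
  · exact absurd hclg n₁₅
  · exact absurd hclg n₃
  · exact absurd hclg n₅'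
  · exact absurd hclg n₃'
  · exact absurd hclg n₅

lemma finite_prime {q : ℕ} (hq : q.Prime) (h8 : q % 8 = 7) (h3 : q % 3 = 2)
    (h5 : ¬ IsSquare (q : ZMod 5)) : Finite (twistModel q).toAffine.Point := by
  have : Fact q.Prime := ⟨hq⟩
  have hq0 : (q : ℤ) ≠ 0 := by exact_mod_cast hq.ne_zero
  have hq0' : (q : ℚ) ≠ 0 := by exact_mod_cast hq.ne_zero
  have n₁ := not_hasClass_neg_one hq h8 h3 h5 (c := 1) (by simp)
  have n₃' := not_hasClass_neg_three hq h8 h3 h5 (c := 1) (by simp)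
  have n₃ := not_hasClass_three (d := (q : ℤ)) ⟨q / 8, by omega⟩
  rw [mul_one] at n₁ n₃'
  refine finite_of_classes hq0' (fun x y => exists_eq_sq_prime hq h8 h3) fun X w hX hw h => ?_
  refine exists_class_trivial hq hq0 (Dvd.intro_left _ rfl) n₁ n₃ n₃' (fun g hg h => ?_) hX hw
    (by exact_mod_cast h)
  refine HasClass.of_mul_sq hq0' ?_
  have := h.mul_d (by exact_mod_cast hq0) (mul_ne_zero hq0' hg)
  convert this using 1
  push_cast
  ring

lemma finite_neg_fifteen_mul_prime {q : ℕ} (hq : q.Prime) (h8 : q % 8 = 7) (h3 : q % 3 = 2)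
    (h5 : ¬ IsSquare (q : ZMod 5)) : Finite (twistModel (-15 * q)).toAffine.Point := by
  have : Fact q.Prime := ⟨hq⟩
  have hq0' : (q : ℚ) ≠ 0 := by exact_mod_cast hq.ne_zero
  have hd : (q * -15 : ℤ) ≠ 0 := mul_ne_zero (by exact_mod_cast hq.ne_zero) (by norm_num)
  have hdq : ((q * -15 : ℤ) : ℚ) ≠ 0 := by exact_mod_cast hd
  have hc : ((-15 : ℤ) : ZMod q) ≠ 0 := by
    intro h
    refine not_isSquare_fifteen h8 h3 h5 ⟨0, ?_⟩
    push_cast at h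
    rw [neg_eq_zero.mp h, mul_zero]
  have n₁ := not_hasClass_neg_one hq h8 h3 h5 hc
  have n₃' := not_hasClass_neg_three hq h8 h3 h5 hc
  have n₃ := not_hasClass_three (d := q * -15) ⟨-15 * (q / 8 : ℕ) - 14, by omega⟩
  refine finite_of_classes (mul_ne_zero (by norm_num) hq0')
    (fun x y => exists_eq_sq_neg_fifteen hq h8 h3 h5) fun X w hX hw h => ?_
  obtain ⟨s, hs⟩ := exists_class_trivial hq hd ⟨-1, by ring⟩ n₁ n₃ n₃' (fun g hg h => by
    refine HasClass.of_mul_sq (k := 15 * q) (mul_ne_zero (by norm_num) hq0') ?_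
    have := (h.mul_d hdq (mul_ne_zero hq0' hg)).neg_fifteen_mul hdq
      (mul_ne_zero hdq (mul_ne_zero hq0' hg))
    convert this using 1
    push_cast
    ring) hX hw (by push_cast; linear_combination h)
  rcases hs with hs | hs | hs | hs
  · exact ⟨s, Or.inl hs⟩
  · exact ⟨s, Or.inr (Or.inl hs)⟩
  · exact ⟨s / 15, Or.inr (Or.inr (Or.inr (by rw [hs]; ring)))⟩
  · exact ⟨s, Or.inr (Or.inr (Or.inl hs))⟩

end Finiteness

end twistModel

/-! ### Twists over quadratic fields and the rank -/

section QuadraticExtension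

lemma sq_eq_of_modelX₁Fifteen {R : Type*} [CommRing R] {x y : R}
    (h : y ^ 2 + x * y + y = x ^ 3 + x ^ 2) :
    (2 * y + x + 1) ^ 2 = 4 * x ^ 3 + 5 * x ^ 2 + 2 * x + 1 := by
  linear_combination 4 * h

/-- The rational points of a twist of `y² + xy + y = x³ + x²`, in the form `dz² = (2y + x + 1)²`. -/
lemma finite_setOf_twist {d : ℚ} (hd : d ≠ 0) (h : Finite (twistModel d).toAffine.Point) :
    {x : ℚ | ∃ z, d * z ^ 2 = 4 * x ^ 3 + 5 * x ^ 2 + 2 * x + 1}.Finite := by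
  have key (x z : ℚ) (hz : d * z ^ 2 = 4 * x ^ 3 + 5 * x ^ 2 + 2 * x + 1) :
      (twistModel d).toAffine.Nonsingular (4 * d * (x + 1)) (4 * d ^ 2 * z) := by
    rw [twistModel_nonsingular_iff hd]
    linear_combination 16 * d ^ 3 * hz
  have : Finite {x : ℚ | ∃ z, d * z ^ 2 = 4 * x ^ 3 + 5 * x ^ 2 + 2 * x + 1} := by
    refine Finite.of_injective
      (fun x => Point.some _ _ (key x.1 x.2.choose x.2.choose_spec)) fun x x' hx => Subtype.ext ?_
    have h0 : 4 * d ≠ 0 := mul_ne_zero four_ne_zero hd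
    exact add_right_cancel (mul_left_cancel₀ h0 (Point.some.inj hx).1)
  exact Set.toFinite _

variable {K : Type} [Field K] [Algebra ℚ K]

/-- The points of `y² + xy + y = x³ + x²` over a quadratic extension `ℚ(δ)` are finite in number if
this is so for the rational points of the curve and of its twist by `δ²`: with `σ` the conjugation,
`2P` is the sum of the `σ`-invariant point `P + σP` and of the `σ`-anti-invariant point `P - σP`. -/
lemma finite_modelX₁Fifteen (σ : K →ₐ[ℚ] K) (hσ : ∀ x, σ (σ x) = x) {d : ℚ} {δ : K}
    (hδ : δ ^ 2 = algebraMap ℚ K d) (hfix : ∀ x, σ x = x → ∃ a, x = algebraMap ℚ K a)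
    (hanti : ∀ x, σ x = -x → ∃ a, x = algebraMap ℚ K a * δ)
    (h₁ : {x : ℚ | ∃ z, 1 * z ^ 2 = 4 * x ^ 3 + 5 * x ^ 2 + 2 * x + 1}.Finite)
    (hd : {x : ℚ | ∃ z, d * z ^ 2 = 4 * x ^ 3 + 5 * x ^ 2 + 2 * x + 1}.Finite) :
    Finite (modelX₁Fifteen.baseChange K).toAffine.Point := by
  classical
  have hinj : Function.Injective (algebraMap ℚ K) := (algebraMap ℚ K).injective
  let s := Point.map (W' := modelX₁Fifteen) σ
  have hs : ∀ P, s (s P) = P := by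
    intro P
    rcases P with _ | ⟨x, y, h⟩
    · rfl
    · simp [s, Point.map_some, hσ]
  have hfin₁ : {P | s P = P}.Finite := by
    refine Point.finite_of_finite_x (h₁.image (algebraMap ℚ K)) fun x y h hP => ?_
    have hP' : s (Point.some x y h) = Point.some x y h := hP
    rw [Point.map_some, Point.some.injEq] at hP'
    obtain ⟨a, rfl⟩ := hfix x hP'.1
    obtain ⟨b, rfl⟩ := hfix y hP'.2
    refine ⟨a, ⟨2 * b + a + 1, hinj ?_⟩, rfl⟩
    rw [modelX₁Fifteen_nonsingular_iff] at h
    have := sq_eq_of_modelX₁Fifteen h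
    simp only [map_add, map_mul, map_pow, map_ofNat, map_one, one_mul]
    exact this
  have hfin₂ : {P | s P = -P}.Finite := by
    refine Point.finite_of_finite_x (hd.image (algebraMap ℚ K)) fun x y h hP => ?_
    have hP' : s (Point.some x y h) = -Point.some x y h := hP
    rw [Point.map_some, Point.neg_some, Point.some.injEq] at hP'
    obtain ⟨hx, hy⟩ := hP'
    rw [modelX₁Fifteen_nonsingular_iff] at h
    have hy' : σ y = -y - x - 1 := by
      rw [hy]
      simp [negY, modelX₁Fifteen]
    obtain ⟨b, hb⟩ := hanti (2 * y + x + 1) (by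
      simp only [map_add, map_mul, map_ofNat, map_one, hx, hy']
      ring)
    obtain ⟨a, rfl⟩ := hfix x hx
    refine ⟨a, ⟨b, hinj ?_⟩, rfl⟩
    have := sq_eq_of_modelX₁Fifteen h
    rw [hb] at this
    simp only [map_add, map_mul, map_pow, map_ofNat, map_one]
    linear_combination this - (algebraMap ℚ K b) ^ 2 * hδ
  have htor : {P : (modelX₁Fifteen.baseChange K).toAffine.Point | 2 • P = 0}.Finite := by
    have hp : (⟨4, 5, 2, 1⟩ : Cubic K).toPoly ≠ 0 := by
      have : CharZero K := algebraRat.charZero K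
      exact Cubic.ne_zero_of_a_ne_zero (by norm_num : (4 : K) ≠ 0)
    refine Point.finite_of_finite_x (Polynomial.finite_setOfPred_isRoot hp) fun x y h hP => ?_
    have hP' : 2 • Point.some x y h = 0 := hP
    rw [two_nsmul, Point.add_self_eq_zero_iff] at hP'
    rw [modelX₁Fifteen_nonsingular_iff] at h
    have := sq_eq_of_modelX₁Fifteen h
    have h0 : 2 * y + x + 1 = 0 := by
      simpa [modelX₁Fifteen] using hP'
    rw [h0] at this
    simp only [Set.mem_ofPred_eq, Polynomial.IsRoot, Cubic.toPoly, Polynomial.eval_add,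
      Polynomial.eval_mul, Polynomial.eval_pow, Polynomial.eval_C, Polynomial.eval_X]
    linear_combination -this
  rw [← Set.finite_univ_iff]
  refine ((hfin₁.prod hfin₂).preimage' (f := fun P => (P + s P, P - s P)) ?_).subset ?_
  · rintro ⟨Q, R⟩ -
    by_cases hne : ∃ P₀, (P₀ + s P₀, P₀ - s P₀) = (Q, R)
    · obtain ⟨P₀, hP₀⟩ := hne
      refine (htor.image (· + P₀)).subset fun P hP => ⟨P - P₀, ?_, by simp⟩
      rw [← hP₀] at hP
      obtain ⟨e₁, e₂⟩ := Prod.mk.inj (show (P + s P, P - s P) = _ from hP)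
      change 2 • (P - P₀) = 0
      have : 2 • (P - P₀) = (P + s P + (P - s P)) - (P₀ + s P₀ + (P₀ - s P₀)) := by abel
      rw [this, e₁, e₂, sub_self]
    · exact Set.finite_empty.subset fun P hP => hne ⟨P, hP⟩
  · intro P _
    refine ⟨?_, ?_⟩
    · change s (P + s P) = P + s P
      rw [map_add, hs, add_comm]
    · change s (P - s P) = -(P - s P)
      rw [map_sub, hs, neg_sub]

/-- Every model of `X₁(15)` has as many points over `K` as the given one, up to finitely many. -/
lemma IsModularCurveX₁.finite_point {X : WeierstrassCurve ℚ} (hX : IsModularCurveX₁ 15 X)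
    (h : Finite (modelX₁Fifteen.baseChange K).toAffine.Point) :
    Finite (X.baseChange K).toAffine.Point := by
  obtain ⟨-, f, hf, hcusps, -⟩ := hX
  have hrange : (Set.range (f K)).Finite := by
    choose A hA using fun P : Set.range (f K) => P.2
    refine Finite.of_injective (fun P => (A P).toModel) fun P Q hPQ => Subtype.ext ?_
    rw [← hA P, ← hA Q, hf K, ← EllipticCurveWithPoint.toModel_eq_iff]
    exact hPQ
  rw [← Set.finite_univ_iff, ← Set.union_compl_self (Set.range (f K))]
  exact hrange.union (hcusps K)

/-- Over a field containing a square root of `d`, the twist by `d` becomes isomorphic to the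
curve. -/
lemma finite_quadraticTwist {X : WeierstrassCurve ℚ} [X.IsElliptic] {d : ℚ} (hd : d ≠ 0) {δ : K}
    (hδ : δ ^ 2 = algebraMap ℚ K d) (h : Finite (X.baseChange K).toAffine.Point) :
    Finite (quadraticTwist X d).toAffine.Point := by
  have hinj : Function.Injective (algebraMap ℚ K) := (algebraMap ℚ K).injective
  have : CharZero K := algebraRat.charZero K
  have hd' : algebraMap ℚ K d ≠ 0 := by simpa using hd
  have hδ0 : δ ≠ 0 := by rintro rfl; exact hd' (by rw [← hδ]; ring)
  have : (X.baseChange K).toAffine.IsElliptic :=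
    inferInstanceAs (X.map (algebraMap ℚ K)).IsElliptic
  have key (x y : ℚ) (hxy : (quadraticTwist X d).toAffine.Nonsingular x y) :
      ∃ v, (X.baseChange K).toAffine.Nonsingular (algebraMap ℚ K (x / d)) v := by
    have e := (equation_iff _ _).mp hxy.1
    refine ⟨algebraMap ℚ K y / (algebraMap ℚ K d * δ) -
      (algebraMap ℚ K X.a₁ * algebraMap ℚ K (x / d) + algebraMap ℚ K X.a₃) / 2, ?_⟩
    rw [← equation_iff_nonsingular, equation_iff]
    have e' := congrArg (algebraMap ℚ K) e
    simp only [quadraticTwist, map_add, map_mul, map_pow, map_div₀, map_ofNat, map_zero,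
      WeierstrassCurve.b₂, WeierstrassCurve.b₄, WeierstrassCurve.b₆] at e'
    change _ ^ 2 + algebraMap ℚ K X.a₁ * _ * _ + algebraMap ℚ K X.a₃ * _ =
      _ ^ 3 + algebraMap ℚ K X.a₂ * _ ^ 2 + algebraMap ℚ K X.a₄ * _ + algebraMap ℚ K X.a₆
    rw [map_div₀]
    rw [← hδ] at e' hd' ⊢
    field_simp at e' ⊢
    linear_combination (1 / 2) * e'
  rw [← Set.finite_univ_iff]
  refine Point.finite_of_finite_x
    (S := {x : ℚ | ∃ y, (quadraticTwist X d).toAffine.Nonsingular x y}) ?_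
    fun x y h _ => ⟨y, h⟩
  choose! v hv using key
  have : Finite {x : ℚ | ∃ y, (quadraticTwist X d).toAffine.Nonsingular x y} := by
    refine Finite.of_injective
      (fun x => Point.some _ _ (hv x.1 x.2.choose x.2.choose_spec)) fun x x' hx => Subtype.ext ?_
    exact (div_left_inj' hd).mp (hinj (Point.some.inj hx).1)
  exact Set.toFinite _

lemma mordellWeilRank_eq_zero {W : WeierstrassCurve ℚ} (h : Finite W.toAffine.Point) :
    mordellWeilRank W = 0 := by
  rw [mordellWeilRank, rank_eq_zero_iff]
  intro P
  refine ⟨addOrderOf P, by exact_mod_cast (addOrderOf_pos P).ne', ?_⟩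
  rw [natCast_zsmul, addOrderOf_nsmul_eq_zero]

/-- The field `ℚ(√d)` with its conjugation. -/
lemma exists_quadratic_extension {d : ℚ} (hd : ¬ IsSquare d) :
    ∃ (K : Type) (_ : Field K) (_ : Algebra ℚ K) (σ : K →ₐ[ℚ] K) (δ : K),
      (∀ x, σ (σ x) = x) ∧ δ ^ 2 = algebraMap ℚ K d ∧
        (∀ x, σ x = x → ∃ a, x = algebraMap ℚ K a) ∧
        ∀ x, σ x = -x → ∃ a, x = algebraMap ℚ K a * δ := by
  have : Fact (∀ r : ℚ, r ^ 2 ≠ d + 0 * r) :=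
    ⟨fun r hr => hd ⟨r, by linear_combination -hr⟩⟩
  refine ⟨QuadraticAlgebra ℚ d 0, inferInstance, DivisionRing.toRatAlgebra,
    (starRingEnd (QuadraticAlgebra ℚ d 0)).toRatAlgHom, ⟨0, 1⟩, fun x => star_star x, ?_, ?_, ?_⟩
  · rw [eq_ratCast]
    ext <;> simp [sq]
  · intro x hx
    have h2 : -x.im = x.im := by simpa using congrArg QuadraticAlgebra.im (show star x = x from hx)
    refine ⟨x.re, ?_⟩
    rw [eq_ratCast]
    ext
    · simp
    · simp; linarith
  · intro x hx
    have h2 : x.re = -x.re := by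
      simpa using congrArg QuadraticAlgebra.re (show star x = -x from hx)
    refine ⟨x.im, ?_⟩
    rw [eq_ratCast]
    ext
    · simp; linarith
    · simp

end QuadraticExtension

/-- The twist by a nonsquare `d` of any model of `X₁(15)` has rank `0` as soon as the twist by `d` of
`y² + xy + y = x³ + x²` has only finitely many rational points. -/
lemma IsModularCurveX₁.mordellWeilRank_quadraticTwist {X : WeierstrassCurve ℚ}
    (hX : IsModularCurveX₁ 15 X) {d : ℚ} (hd : ¬ IsSquare d)
    (h : Finite (twistModel d).toAffine.Point) : mordellWeilRank (quadraticTwist X d) = 0 := by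
  have hd0 : d ≠ 0 := by rintro rfl; exact hd ⟨0, by simp⟩
  have := hX.1
  obtain ⟨K, _, _, σ, δ, hσ, hδ, hfix, hanti⟩ := exists_quadratic_extension hd
  exact mordellWeilRank_eq_zero (finite_quadraticTwist hd0 hδ (hX.finite_point
    (finite_modelX₁Fifteen σ hσ hδ hfix hanti
      (finite_setOf_twist one_ne_zero twistModel.finite_one) (finite_setOf_twist hd0 h))))

theorem theorem5 :
    (∃ X : WeierstrassCurve ℚ, IsModularCurveX₁ 15 X) ∧
    ∀ X : WeierstrassCurve ℚ, IsModularCurveX₁ 15 X →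
      ∀ p : ℕ, p.Prime → p ≡ 7 [MOD 8] → p ≡ 2 [MOD 3] → jacobiSym (p : ℤ) 5 = -1 →
        mordellWeilRank (quadraticTwist X (p : ℚ)) = 0 ∧
        mordellWeilRank (quadraticTwist X (-15 * (p : ℚ))) = 0 := by
  refine ⟨⟨_, isModularCurveX₁_modelX₁Fifteen⟩, fun X hX p hp h8 h3 h5 => ?_⟩
  have h5' : ¬ IsSquare (p : ZMod 5) := by
    have : Fact (Nat.Prime 5) := ⟨Nat.prime_five⟩
    rw [← jacobiSym.legendreSym.to_jacobiSym, legendreSym.eq_neg_one_iff] at h5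
    exact_mod_cast h5
  have hp0 : (0 : ℚ) < p := by exact_mod_cast hp.pos
  refine ⟨hX.mordellWeilRank_quadraticTwist ?_ (twistModel.finite_prime hp h8 h3 h5'),
    hX.mordellWeilRank_quadraticTwist ?_ (twistModel.finite_neg_fifteen_mul_prime hp h8 h3 h5')⟩
  · rw [Rat.isSquare_natCast_iff]
    exact hp.prime.not_isSquare
  · rintro ⟨r, hr⟩
    nlinarith [mul_self_nonneg r]
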